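/- **Setting.** Let $(E,\mathscr B,\mathbf m)$ be a $\sigma$-finite measure space with countably generated $\mathscr B$, and let $(L,D(L))$ be a negative definite self-adjoint operator on $L^2(\mathbf m)$ with $\ker L=\{0\}$. Put $D(\mathscr E)=D(\sqrt{-L})$, $\mathscr E(u,v)=\mathbf m(\sqrt{-L}u\,\sqrt{-L}v)$, let $\mathscr F_e$ be the completion of $D(\mathscr E)$ with respect to $\|\cdot\|_{\mathscr F_e}=\mathscr E(\cdot,\cdot)^{1/2}$, and let $H=\mathscr F_e^*$ with the inner product given by the Riesz isomorphism. A Young function is a nonnegative, continuous, convex, even $N:\mathbb R\to\mathbb R$ with $N(s)=0$ iff $s=0$, $N(s)/s\to0$ as $s\to0$ and $N(s)/s\to\infty$ as $s\to\infty$; its dual is $N^*(s)=\sup_{r\ge0}(r|s|-N(r))$. It is $\Delta_2$-regular if for some $c>0$, $N(2s)\le c\,(N(s)+1_{\{\mathbf m(E)<\infty\}})$ for all $s$. For a measure $\mu$, $L_N(\mu)$ is the space of all $f$ with $\mu(N(af))<\infty$ for some $a>0$, with norm $\inf\{\lambda>0:\mu(N(f/\lambda))\le1\}$; $L_N=L_N(\mathbf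 m)$. Fix $N$ such that $N$ and $N^*$ are $\Delta_2$-regular. Let $$V=H\cap L_N=\{u\in L_N:\ \exists c>0\ \ \mathbf m(uv)\le c\|v\|_{\mathscr F_e}\ \forall v\in\mathscr F_e\cap L_{N^*}\},\qquad \|u\|_V=\|u\|_{L_N}+\|u\|_H,$$ where $u\in V$ is identified with the element $\bar u$ of $H$ such that $\bar u(v)=\mathbf m(uv)$, $v\in\mathscr F_e\cap L_{N^*}$. Assume: * (L1) there is a strictly positive $g\in L^1(\mathbf m)\cap L^\infty(\mathbf m)$ with $\mathscr F_e\subset L^1(g\cdot\mathbf m)$ continuously (so that elements of $\mathscr F_e$ are functions); * (N1) $\mathscr F_e\cap L_{N^*}$ is dense in $\mathscr F_e$ and in $L_{N^*}$; * (N2) $V$ is dense in $H$ and in $L_N$. Using $V\subset H\equiv H^*\subset V^*$, let $\bar L:L_{N^*}\to V^*$ be the unique continuous linear extension of $\mathscr F_e\cap L_{N^*}\ni v\mapsto-\mathscr E(v,\cdot)\in\mathscr F_e^*=H\subset V^*$. Let $T>0$, let $(\Omega,\mathscr F,(\mathscr F_t)_{t\ge0},P)$ be a filtered probability space, and $G$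 a real separable Hilbert space. Let $\Psi,\Phi:[0,\infty)\times\mathbb R\times\Omega\to\mathbb R$ be progressively measurable, and continuous in the second variable. Let $B:[0,T]\times V\times\Omega\to\mathscr L_{HS}(G;H)$ be progressively measurable with $\|B(t,u)-B(t,v)\|_{\mathscr L_{HS}}^2\le c\|u-v\|_H^2$ on $[0,T]\times\Omega$ for all $u,v\in V$ and some $c\in\mathbb R$, and with $B(\cdot,0)\in L^2([0,T]\times\Omega\to\mathscr L_{HS}(G;H);dt\times P)$. Let $h$ be an $\mathscr F_t$-adapted, jointly measurable process, bounded on $[0,T]\times\Omega$, and write $\Phi(t,s)=h_ts+\Phi_0(t,s)$ for $t\in[0,T]$. Assume (A1) or (A2), where the inequalities hold on $[0,T]\times\Omega$ for all $s,s_1,s_2\in\mathbb R$: * (A1) $\Phi_0=0$, and there are a nonnegative $\mathscr F_t$-adapted $f\in L^1([0,T]\times\Omega;dt\times P)$ and $c\ge1$ such that $(s_2-s_1)(\Psi(\cdot,s_2)-\Psi(\cdot,s_1))\ge0$, $\ N(s)-1_{\{\mathbf m(E)<\infty\}}f\le s\Psi(\cdot,s)\le c\,(N(s)+1_{\{\mathbf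 m(E)<\infty\}}f)$, and $N^*(\Psi(\cdot,0))1_{\{\mathbf m(E)<\infty\}}\in L^1([0,T]\times\Omega;dt\times P)$. * (A2) $N(s)=\sum_{i=1}^k\varepsilon_i|s|^{r_i+1}$ with $\varepsilon_i>0$ and pairwise distinct $r_i>0$. For each $i$ the set $\{Lu:\ u\in D(L)\cap L_N,\ Lu\in L^{r_i+1}(\mathbf m)\}$ is dense in $L^{r_i+1}(\mathbf m)$, and $L^{-1}$ on this set extends to a bounded operator on $L^{r_i+1}(\mathbf m)$, again denoted by $L^{-1}$; these extensions agree on $L_N=\bigcap_iL^{r_i+1}(\mathbf m)$. With $\kappa_i=\|L^{-1}\|_{\mathscr L(L^{r_i+1}(\mathbf m))}^{-1}$ there are a nonnegative $\mathscr F_t$-adapted $f\in L^1([0,T]\times\Omega;dt\times P)$, $c\ge0$, $\delta_1,\dots,\delta_k>0$ and $\varepsilon\in(0,1)$ such that $(s_2-s_1)(\Psi(\cdot,s_2)-\Psi(\cdot,s_1))\ge\sum_i\delta_i|s_2-s_1|^{r_i+1}$, $\ N(s)-f1_{\{\mathbf m(E)<\infty\}}\le s\Psi(\cdot,s)\le c\,(N(s)+f1_{\{\mathbf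 m(E)<\infty\}})$, $\ |\Phi_0(\cdot,s_2)-\Phi_0(\cdot,s_1)|\le\sum_i\delta_i\kappa_i|s_2-s_1|^{r_i}$ and $|\Phi_0(\cdot,s)|\le\sum_i\varepsilon\kappa_i\varepsilon_i|s|^{r_i}$. For $t\in[0,T]$, $v\in V$ define $$A(t,v)=\bar L\Psi(t,v)+\bar\Phi(t,v),\qquad\bar\Phi(t,v)=h_tv-\mathbf m\bigl(\Phi_0(t,v)\,L^{-1}\,\cdot\,\bigr),$$ $R(v)=\mathbf m(N(v))+\|v\|_H^2$, and $K=L_N([0,T]\times E\times\Omega;dt\times\mathbf m\times P)\cap L^2([0,T]\times\Omega\to H;dt\times P)$ with the sum of the two norms; elements $z\in K$ are regarded as $V$-valued functions $(t,\omega)\mapsto z_t(\omega)$ on $[0,T]\times\Omega$. **Proposition 3.8.** The extension $\bar L$ exists and is unique, $R$ is finite on $V$, $A$ is well defined with values in $V^*$, and the following conditions hold. * (K) $R:V\to[0,\infty)$ is continuous, $R(x)=R(-x)$, $R(0)=0$, and: (i) for any sequence $z^{(n)}\in K$, $\|z^{(n)}\|_K\to0$ if and only if $\mathbb E\int_0^TR(z^{(n)}_t)\,dt\to0$;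 (ii) there are locally bounded $W_1,W_2:[0,\infty)\to\mathbb R$ with $W_1(r),W_2(r)\to\infty$ as $r\to\infty$ such that, for all $z\in K$, $\mathbb E\int_0^TR(z_t)\,dt<\infty$ and $W_1(\mathbb E\int_0^TR(z_t)\,dt)\le\|z\|_K\le W_2(\mathbb E\int_0^TR(z_t)\,dt)$; (iii) there is $C>0$ with $R(x+y)\le C(R(2x)+R(2y))$ for all $x,y\in V$; (iv) for $\eta\in L^\infty([0,T]\times\Omega;dt\times P)$ and $z\in K$ one has $\eta z\in K$ and $\|\eta z\|_K\le\|\eta\|_\infty\|z\|_K$. * (H1) For all $u,v,x\in V$, $\omega\in\Omega$, $t\in[0,T]$ the map $\lambda\mapsto{}_{V^*}\langle A(t,u+\lambda v,\omega),x\rangle_V$ is continuous on $\mathbb R$. * (H2) There is $c\in\mathbb R$ with $2\,{}_{V^*}\langle A(\cdot,u)-A(\cdot,v),u-v\rangle_V+\|B(\cdot,u)-B(\cdot,v)\|_{\mathscr L_{HS}}^2\le c\|u-v\|_H^2$ on $[0,T]\times\Omega$ for all $u,v\in V$. * (H3) There are $c_1,c_2>0$ and an $\mathscr F_t$-adapted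 $f\in L^1([0,T]\times\Omega;dt\times P)$ with $2\,{}_{V^*}\langle A(t,v),v\rangle_V+\|B(t,v)\|_{\mathscr L_{HS}}^2\le c_1\|v\|_H^2-c_2R(v)+f_t$ on $\Omega$ for all $v\in V$, $t\in[0,T]$. * (H4) There are $c_3>0$ and an $\mathscr F_t$-adapted $g\in L^1([0,T]\times\Omega;dt\times P)$ with $|{}_{V^*}\langle A(t,v),u\rangle_V|\le g_t+c_3(R(v)+R(u))$ on $\Omega$ for all $u,v\in V$, $t\in[0,T]$. -/

import Mathlib

open MeasureTheory Filter Topology Set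
open scoped NNReal ENNReal

noncomputable section

namespace PorousMedia

/-- A Young function: nonnegative, continuous, convex, even, vanishing only at `0`, with
`N(s)/s → 0` as `s → 0` and `N(s)/s → ∞` as `s → ∞`. -/
structure YoungFunction where
  toFun : ℝ → ℝ
  nonneg' : ∀ s, 0 ≤ toFun s
  continuous' : Continuous toFun
  convex' : ConvexOn ℝ univ toFun
  even' : ∀ s, toFun (-s) = toFun s
  eq_zero_iff' : ∀ s, toFun s = 0 ↔ s = 0
  tendsto_zero' : Tendsto (fun s => toFun s / s) (𝓝[≠] 0) (𝓝 0)
  tendsto_atTop' : Tendsto (fun s => toFun s / s) atTop atTop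

namespace YoungFunction

instance : CoeFun YoungFunction (fun _ => ℝ → ℝ) := ⟨toFun⟩

theorem map_zero (N : YoungFunction) : N 0 = 0 := (N.eq_zero_iff' 0).2 rfl

theorem pos (N : YoungFunction) {s : ℝ} (hs : s ≠ 0) : 0 < N s :=
  lt_of_le_of_ne (N.nonneg' s) (fun h => hs ((N.eq_zero_iff' s).1 h.symm))

theorem scale_le (N : YoungFunction) {a : ℝ} (ha0 : 0 ≤ a) (ha1 : a ≤ 1) (s : ℝ) :
    N (a * s) ≤ a * N s := by
  have h := N.convex'.2 (mem_univ s) (mem_univ (0 : ℝ)) ha0 (sub_nonneg.2 ha1) (by ring)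
  simpa [N.map_zero] using h

theorem abs_eq (N : YoungFunction) (s : ℝ) : N |s| = N s := by
  rcases abs_choice s with h | h <;> rw [h]
  exact N.even' s

theorem mono (N : YoungFunction) {s t : ℝ} (h : |s| ≤ |t|) : N s ≤ N t := by
  rw [← N.abs_eq s, ← N.abs_eq t]
  rcases (abs_nonneg t).eq_or_lt with ht | ht
  · have : |s| = 0 := le_antisymm (ht ▸ h) (abs_nonneg s)
    rw [this, ← ht]
  · have h1 : |s| / |t| ≤ 1 := (div_le_one ht).2 h
    have h0 : 0 ≤ |s| / |t| := by positivity
    calc N |s| = N (|s| / |t| * |t|) := by rw [div_mul_cancel₀ _ ht.ne']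
      _ ≤ |s| / |t| * N |t| := N.scale_le h0 h1 _
      _ ≤ 1 * N |t| := by gcongr; exact N.nonneg' _
      _ = N |t| := one_mul _

theorem dual_bddAbove (N : YoungFunction) (s : ℝ) :
    BddAbove ((fun r => r * |s| - N r) '' Ici 0) := by
  obtain ⟨r₀, hr₀⟩ := (tendsto_atTop_atTop.1 N.tendsto_atTop') |s|
  refine ⟨max r₀ 1 * |s|, ?_⟩
  rintro _ ⟨r, hr, rfl⟩
  have hr' : (0 : ℝ) ≤ r := hr
  rcases le_total r (max r₀ 1) with h | h
  · have := N.nonneg' r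
    have := mul_le_mul_of_nonneg_right h (abs_nonneg s)
    simp only; linarith
  · have hpos : 0 < r := lt_of_lt_of_le (by positivity) h
    have h1 := hr₀ r (le_trans (le_max_left _ _) h)
    rw [le_div_iff₀ hpos] at h1
    have : 0 ≤ max r₀ 1 * |s| := by positivity
    simp only; nlinarith

/-- The value of the dual function `N*(s) = sup {r|s| - N(r) : r ≥ 0}`. -/
def dualFun (N : YoungFunction) (s : ℝ) : ℝ := sSup ((fun r => r * |s| - N r) '' Ici 0)

theorem le_dualFun (N : YoungFunction) {r : ℝ} (hr : 0 ≤ r) (s : ℝ) :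
    r * |s| - N r ≤ N.dualFun s :=
  le_csSup (N.dual_bddAbove s) ⟨r, hr, rfl⟩

theorem dualFun_le (N : YoungFunction) {s C : ℝ} (h : ∀ r, 0 ≤ r → r * |s| - N r ≤ C) :
    N.dualFun s ≤ C :=
  csSup_le ⟨_, 0, mem_Ici.2 le_rfl, rfl⟩ (by rintro _ ⟨r, hr, rfl⟩; exact h r hr)

theorem dualFun_nonneg (N : YoungFunction) (s : ℝ) : 0 ≤ N.dualFun s := by
  simpa [N.map_zero] using N.le_dualFun le_rfl s

theorem dualFun_convex (N : YoungFunction) : ConvexOn ℝ univ N.dualFun := by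
  refine ⟨convex_univ, fun x _ y _ a b ha hb hab => N.dualFun_le fun r hr => ?_⟩
  have h1 := mul_le_mul_of_nonneg_left (N.le_dualFun hr x) ha
  have h2 := mul_le_mul_of_nonneg_left (N.le_dualFun hr y) hb
  have h3 : |a * x + b * y| ≤ a * |x| + b * |y| := by
    refine (abs_add_le _ _).trans_eq ?_
    rw [abs_mul, abs_mul, abs_of_nonneg ha, abs_of_nonneg hb]
  have h4 := mul_le_mul_of_nonneg_left h3 hr
  have h5 : N r = a * N r + b * N r := by rw [← add_mul, hab, one_mul]
  simp only [smul_eq_mul]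
  nlinarith

theorem dualFun_tendsto_zero (N : YoungFunction) :
    Tendsto (fun s => N.dualFun s / s) (𝓝[≠] 0) (𝓝 0) := by
  rw [Metric.tendsto_nhdsWithin_nhds]
  intro ε hε
  have hNε : 0 < N (ε / 2) := N.pos (by positivity)
  refine ⟨N (ε / 2) / (ε / 2), by positivity, fun s hs hd => ?_⟩
  rw [Real.dist_eq, sub_zero] at hd
  have hspos : 0 < |s| := abs_pos.2 hs
  have key : N.dualFun s ≤ ε / 2 * |s| := by
    refine N.dualFun_le fun r hr => ?_
    rcases le_total r (ε / 2) with h | h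
    · have := N.nonneg' r
      have := mul_le_mul_of_nonneg_right h hspos.le
      linarith
    · have hrpos : 0 < r := by linarith
      have h1 : (ε / 2) / r ≤ 1 := (div_le_one hrpos).2 h
      have h2 := N.scale_le (by positivity : 0 ≤ (ε / 2) / r) h1 r
      rw [div_mul_cancel₀ _ hrpos.ne'] at h2
      have h3 : N (ε / 2) * r ≤ ε / 2 * N r := by
        rw [div_mul_eq_mul_div, le_div_iff₀ hrpos] at h2
        exact h2
      have h4 : |s| * (ε / 2) < N (ε / 2) := by rwa [lt_div_iff₀ (by positivity)] at hd
      have h5 : r * |s| ≤ N r := by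
        have : r * (|s| * (ε / 2)) ≤ r * N (ε / 2) := by gcongr
        have : (ε / 2) * (r * |s|) ≤ (ε / 2) * N r := by linarith
        exact le_of_mul_le_mul_left this (by positivity)
      have : 0 ≤ ε / 2 * |s| := by positivity
      linarith
  rw [Real.dist_eq, sub_zero, abs_div, abs_of_nonneg (N.dualFun_nonneg s), div_lt_iff₀ hspos]
  nlinarith

theorem dualFun_tendsto_atTop (N : YoungFunction) :
    Tendsto (fun s => N.dualFun s / s) atTop atTop := by
  rw [tendsto_atTop_atTop]
  intro b
  refine ⟨max 1 (N (|b| + 1)), fun s hs => ?_⟩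
  have hs1 : 1 ≤ s := (le_max_left _ _).trans hs
  have hs2 : N (|b| + 1) ≤ s := (le_max_right _ _).trans hs
  have hpos : 0 < s := by linarith
  have h := N.le_dualFun (by positivity : 0 ≤ |b| + 1) s
  rw [abs_of_pos hpos] at h
  rw [le_div_iff₀ hpos]
  have : b * s ≤ |b| * s := by gcongr; exact le_abs_self b
  nlinarith

theorem dualFun_eq_zero_iff (N : YoungFunction) (s : ℝ) : N.dualFun s = 0 ↔ s = 0 := by
  constructor
  · intro h
    by_contra hs
    have hspos : 0 < |s| := abs_pos.2 hs
    have h0 := N.tendsto_zero'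
    rw [Metric.tendsto_nhdsWithin_nhds] at h0
    obtain ⟨δ, hδ, hd⟩ := h0 |s| hspos
    have h1 := @hd (δ / 2) (by simp [hδ.ne']) (by
      rw [Real.dist_eq, sub_zero, abs_of_pos (by positivity)]; linarith)
    rw [Real.dist_eq, sub_zero, abs_of_nonneg (div_nonneg (N.nonneg' _) (by positivity)),
      div_lt_iff₀ (by positivity)] at h1
    have h2 := N.le_dualFun (by positivity : 0 ≤ δ / 2) s
    nlinarith
  · rintro rfl
    refine le_antisymm (N.dualFun_le fun r _ => ?_) (N.dualFun_nonneg 0)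
    simpa using N.nonneg' r

/-- The dual Young function `N*`. -/
def dual (N : YoungFunction) : YoungFunction where
  toFun := N.dualFun
  nonneg' := N.dualFun_nonneg
  continuous' := continuousOn_univ.1 (N.dualFun_convex.continuousOn isOpen_univ)
  convex' := N.dualFun_convex
  even' s := by simp [dualFun]
  eq_zero_iff' := N.dualFun_eq_zero_iff
  tendsto_zero' := N.dualFun_tendsto_zero
  tendsto_atTop' := N.dualFun_tendsto_atTop

end YoungFunction

section Orlicz

variable {α : Type*} [MeasurableSpace α]

/-- `μ(N(f)) ∈ [0,∞]`. -/
def modular (N : YoungFunction) (μ : Measure α) (f : α → ℝ) : ℝ≥0∞ :=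
  ∫⁻ x, ENNReal.ofReal (N (f x)) ∂μ

theorem modular_congr (N : YoungFunction) {μ : Measure α} {f g : α → ℝ} (h : f =ᵐ[μ] g) :
    modular N μ f = modular N μ g :=
  lintegral_congr_ae (h.mono fun x hx => by simp only [hx])

theorem modular_convex (N : YoungFunction) {μ : Measure α} {f g : α → ℝ} {a b : ℝ}
    (hf : AEMeasurable f μ) (ha : 0 ≤ a) (hb : 0 ≤ b) (hab : a + b = 1) :
    modular N μ (fun x => a * f x + b * g x) ≤
      ENNReal.ofReal a * modular N μ f + ENNReal.ofReal b * modular N μ g := by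
  unfold modular
  rw [← lintegral_const_mul' _ _ ENNReal.ofReal_ne_top,
    ← lintegral_const_mul' _ _ ENNReal.ofReal_ne_top, ← lintegral_add_left']
  · refine lintegral_mono fun x => ?_
    rw [← ENNReal.ofReal_mul ha, ← ENNReal.ofReal_mul hb,
      ← ENNReal.ofReal_add (mul_nonneg ha (N.nonneg' _)) (mul_nonneg hb (N.nonneg' _))]
    exact ENNReal.ofReal_le_ofReal (by
      simpa using N.convex'.2 (mem_univ (f x)) (mem_univ (g x)) ha hb hab)
  · exact ((N.continuous'.measurable.comp_aemeasurable hf).ennreal_ofReal).const_mul _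

theorem modular_scale (N : YoungFunction) {μ : Measure α} {f : α → ℝ} {a : ℝ}
    (ha : 0 ≤ a) (ha1 : a ≤ 1) :
    modular N μ (fun x => a * f x) ≤ ENNReal.ofReal a * modular N μ f := by
  unfold modular
  rw [← lintegral_const_mul' _ _ ENNReal.ofReal_ne_top]
  refine lintegral_mono fun x => ?_
  rw [← ENNReal.ofReal_mul ha]
  exact ENNReal.ofReal_le_ofReal (N.scale_le ha ha1 _)

/-- The Orlicz space `L_N(μ)`: all a.e.-classes `f` with `μ(N(af)) < ∞` for some `a > 0`. -/
def Orlicz (N : YoungFunction) (μ : Measure α) : Submodule ℝ (α →ₘ[μ] ℝ) where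
  carrier := {f | ∃ a : ℝ, 0 < a ∧ modular N μ (fun x => a * f x) < ∞}
  zero_mem' := by
    refine ⟨1, one_pos, ?_⟩
    have : modular N μ (fun x => 1 * (0 : α →ₘ[μ] ℝ) x) = modular N μ (fun _ => (0 : ℝ)) :=
      modular_congr N (by filter_upwards [AEEqFun.coeFn_zero (μ := μ) (β := ℝ)] with x hx; simp [hx])
    rw [this]
    simp [modular, N.map_zero]
  add_mem' := by
    rintro f g ⟨a, ha, hfa⟩ ⟨b, hb, hgb⟩
    refine ⟨a * b / (a + b), by positivity, ?_⟩
    have h1 : modular N μ (fun x => a * b / (a + b) * (f + g) x) =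
        modular N μ (fun x => b / (a + b) * (a * f x) + a / (a + b) * (b * g x)) := by
      refine modular_congr N ?_
      filter_upwards [AEEqFun.coeFn_add f g] with x hx
      rw [hx, Pi.add_apply]; ring
    rw [h1]
    refine (modular_convex N (f.aestronglyMeasurable.aemeasurable.const_mul a) (by positivity)
      (by positivity) (by field_simp; ring)).trans_lt ?_
    exact ENNReal.add_lt_top.2 ⟨ENNReal.mul_lt_top ENNReal.ofReal_lt_top hfa,
      ENNReal.mul_lt_top ENNReal.ofReal_lt_top hgb⟩
  smul_mem' := by
    rintro c f ⟨a, ha, hfa⟩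
    refine ⟨a / (|c| + 1), by positivity, lt_of_le_of_lt ?_ hfa⟩
    rw [modular_congr N (g := fun x => (a / (|c| + 1)) * (c * f x)) (by
      filter_upwards [AEEqFun.coeFn_smul c f] with x hx
      rw [hx, Pi.smul_apply, smul_eq_mul])]
    refine lintegral_mono fun x => ENNReal.ofReal_le_ofReal (N.mono ?_)
    rw [abs_mul, abs_mul, abs_mul, abs_div, abs_of_pos ha, abs_of_pos (by positivity : 0 < |c| + 1)]
    rw [div_mul_eq_mul_div, div_le_iff₀ (by positivity)]
    nlinarith [abs_nonneg (f x), abs_nonneg c, mul_nonneg ha.le (abs_nonneg (f x))]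

/-- The set whose infimum is the Luxemburg norm. -/
def luxSet (N : YoungFunction) (μ : Measure α) (f : α → ℝ) : Set ℝ :=
  {l | 0 < l ∧ modular N μ (fun x => f x / l) ≤ 1}

/-- The Luxemburg norm `‖f‖_{L_N} = inf {l > 0 : μ(N(f/l)) ≤ 1}`. -/
def luxNorm (N : YoungFunction) (μ : Measure α) (f : α → ℝ) : ℝ := sInf (luxSet N μ f)

theorem luxSet_bddBelow (N : YoungFunction) (μ : Measure α) (f : α → ℝ) :
    BddBelow (luxSet N μ f) := ⟨0, fun _ h => h.1.le⟩

theorem luxSet_congr (N : YoungFunction) {μ : Measure α} {f g : α → ℝ} (h : f =ᵐ[μ] g) :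
    luxSet N μ f = luxSet N μ g := by
  ext l
  simp only [luxSet, mem_ofPred_eq]
  rw [modular_congr N (g := fun x => g x / l) (h.mono fun x hx => by simp only [hx])]

theorem luxNorm_nonneg (N : YoungFunction) (μ : Measure α) (f : α → ℝ) : 0 ≤ luxNorm N μ f :=
  Real.sInf_nonneg fun _ h => h.1.le

theorem luxSet_upper (N : YoungFunction) {μ : Measure α} {f : α → ℝ} {l k : ℝ}
    (hl : l ∈ luxSet N μ f) (h : l ≤ k) : k ∈ luxSet N μ f := by
  have hk : 0 < k := hl.1.trans_le h
  refine ⟨hk, le_trans (lintegral_mono fun x => ENNReal.ofReal_le_ofReal (N.mono ?_)) hl.2⟩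
  rw [abs_div, abs_div, abs_of_pos hk, abs_of_pos hl.1]
  exact div_le_div_of_nonneg_left (abs_nonneg _) hl.1 h

theorem luxSet_nonempty (N : YoungFunction) {μ : Measure α} (f : Orlicz N μ) :
    (luxSet N μ f.1).Nonempty := by
  obtain ⟨a, ha, hf⟩ := f.2
  set M := (modular N μ (fun x => a * f.1 x)).toReal with hM
  have hM0 : 0 ≤ M := ENNReal.toReal_nonneg
  have he : modular N μ (fun x => a * f.1 x) = ENNReal.ofReal M := (ENNReal.ofReal_toReal hf.ne).symm
  refine ⟨(M + 1) / a, by positivity, ?_⟩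
  have h := modular_scale N (μ := μ) (f := fun x => a * f.1 x) (a := 1 / (M + 1)) (by positivity)
    ((div_le_one (by positivity)).2 (by linarith))
  have h2 : (fun x => 1 / (M + 1) * (a * f.1 x)) = fun x => f.1 x / ((M + 1) / a) := by
    funext x; field_simp
  rw [h2, he, ← ENNReal.ofReal_mul (by positivity)] at h
  refine h.trans ?_
  rw [ENNReal.ofReal_le_one, one_div, inv_mul_le_iff₀ (by positivity)]
  linarith

theorem luxSet_of_lt (N : YoungFunction) {μ : Measure α} (f : Orlicz N μ) {l : ℝ}
    (h : luxNorm N μ f.1 < l) : l ∈ luxSet N μ f.1 := by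
  obtain ⟨k, hk, hkl⟩ := exists_lt_of_csInf_lt (luxSet_nonempty N f) h
  exact luxSet_upper N hk hkl.le

theorem luxNorm_add_le (N : YoungFunction) {μ : Measure α} (f g : Orlicz N μ) :
    luxNorm N μ (f + g).1 ≤ luxNorm N μ f.1 + luxNorm N μ g.1 := by
  refine le_of_forall_pos_le_add fun ε hε => ?_
  have hf := luxSet_of_lt N f (lt_add_of_pos_right _ (half_pos hε))
  have hg := luxSet_of_lt N g (lt_add_of_pos_right _ (half_pos hε))
  set a := luxNorm N μ f.1 + ε / 2
  set b := luxNorm N μ g.1 + ε / 2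
  have ha : 0 < a := hf.1
  have hb : 0 < b := hg.1
  have hab : a + b ∈ luxSet N μ (f + g).1 := by
    refine ⟨by positivity, ?_⟩
    have h1 : modular N μ (fun x => (f + g).1 x / (a + b)) =
        modular N μ (fun x => a / (a + b) * (f.1 x / a) + b / (a + b) * (g.1 x / b)) := by
      refine modular_congr N ?_
      filter_upwards [AEEqFun.coeFn_add f.1 g.1] with x hx
      rw [Submodule.coe_add, hx, Pi.add_apply]; field_simp
    rw [h1]
    refine (modular_convex N (f.1.aestronglyMeasurable.aemeasurable.div_const a) (by positivity)
      (by positivity) (by field_simp)).trans ?_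
    calc _ ≤ ENNReal.ofReal (a / (a + b)) * 1 + ENNReal.ofReal (b / (a + b)) * 1 := by
          gcongr
          · exact hf.2
          · exact hg.2
      _ = 1 := by
          rw [mul_one, mul_one, ← ENNReal.ofReal_add (by positivity) (by positivity), ← add_div,
            div_self (by positivity), ENNReal.ofReal_one]
  calc luxNorm N μ (f + g).1 ≤ a + b := csInf_le (luxSet_bddBelow N μ _) hab
    _ = _ := by simp only [a, b]; ring

theorem luxNorm_zero (N : YoungFunction) (μ : Measure α) :
    luxNorm N μ (0 : Orlicz N μ).1 = 0 := by
  refine le_antisymm (le_of_forall_pos_le_add fun ε hε => ?_) (luxNorm_nonneg _ _ _)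
  rw [zero_add]
  refine csInf_le (luxSet_bddBelow N μ _) ⟨hε, ?_⟩
  rw [modular_congr N (g := fun _ => (0 : ℝ)) (by
    filter_upwards [AEEqFun.coeFn_zero (μ := μ) (β := ℝ)] with x hx
    rw [Submodule.coe_zero, hx]; simp)]
  simp [modular, N.map_zero]

theorem luxNorm_neg (N : YoungFunction) {μ : Measure α} (f : Orlicz N μ) :
    luxNorm N μ (-f).1 = luxNorm N μ f.1 := by
  unfold luxNorm
  congr 1
  ext l
  simp only [luxSet, mem_ofPred_eq]
  rw [modular_congr N (g := fun x => -(f.1 x / l)) (by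
    filter_upwards [AEEqFun.coeFn_neg f.1] with x hx
    rw [Submodule.coe_neg, hx, Pi.neg_apply, neg_div])]
  simp only [modular, N.even']

theorem luxNorm_eq_zero (N : YoungFunction) {μ : Measure α} (f : Orlicz N μ)
    (h : luxNorm N μ f.1 = 0) : f = 0 := by
  have hint : modular N μ f.1 = 0 := by
    refine le_antisymm (ENNReal.le_of_forall_pos_le_add fun ε hε _ => ?_) bot_le
    set e : ℝ := min ε 1
    have he : 0 < e := lt_min (by exact_mod_cast hε) one_pos
    have hm := luxSet_of_lt N f (h.trans_lt he)
    have h1 := modular_scale N (μ := μ) (f := fun x => f.1 x / e) he.le (min_le_right _ _)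
    have h2 : (fun x => e * (f.1 x / e)) = f.1 := by funext x; field_simp
    rw [h2] at h1
    calc modular N μ f.1 ≤ ENNReal.ofReal e * 1 := h1.trans (by gcongr; exact hm.2)
      _ ≤ 0 + ε := by
        rw [mul_one, zero_add]
        exact ENNReal.ofReal_le_of_le_toReal (min_le_left _ _)
  have hmeas : AEMeasurable (fun x => ENNReal.ofReal (N (f.1 x))) μ :=
    (N.continuous'.measurable.comp_aemeasurable
      f.1.aestronglyMeasurable.aemeasurable).ennreal_ofReal
  have h0 := (lintegral_eq_zero_iff' hmeas).1 hint
  refine Subtype.ext (AEEqFun.ext ?_)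
  filter_upwards [h0, AEEqFun.coeFn_zero (μ := μ) (β := ℝ)] with x hx hz
  rw [Submodule.coe_zero, hz]
  have : N (f.1 x) ≤ 0 := ENNReal.ofReal_eq_zero.1 hx
  exact (N.eq_zero_iff' _).1 (le_antisymm this (N.nonneg' _))

theorem luxNorm_smul_le (N : YoungFunction) {μ : Measure α} (c : ℝ) (f : Orlicz N μ) :
    luxNorm N μ (c • f).1 ≤ |c| * luxNorm N μ f.1 := by
  rcases eq_or_ne c 0 with rfl | hc
  · rw [zero_smul, luxNorm_zero]; simp
  have hc' : 0 < |c| := abs_pos.2 hc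
  rw [← div_le_iff₀' hc']
  refine le_csInf (luxSet_nonempty N f) fun l hl => ?_
  rw [div_le_iff₀' hc']
  refine csInf_le (luxSet_bddBelow N μ _) ⟨mul_pos hc' hl.1, ?_⟩
  refine le_trans (le_of_eq ?_) hl.2
  refine lintegral_congr_ae ?_
  filter_upwards [AEEqFun.coeFn_smul c f.1] with x hx
  rw [Submodule.coe_smul, hx, Pi.smul_apply, smul_eq_mul, ← N.abs_eq, ← N.abs_eq (f.1 x / l)]
  congr 2
  rw [abs_div, abs_mul, abs_mul, abs_abs, abs_div, mul_div_mul_left _ _ hc'.ne']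

instance (N : YoungFunction) (μ : Measure α) : NormedAddCommGroup (Orlicz N μ) :=
  AddGroupNorm.toNormedAddCommGroup
    { toFun := fun f => luxNorm N μ f.1
      map_zero' := luxNorm_zero N μ
      add_le' := luxNorm_add_le N
      neg' := luxNorm_neg N
      eq_zero_of_map_eq_zero' := luxNorm_eq_zero N }

theorem orlicz_norm_def (N : YoungFunction) {μ : Measure α} (f : Orlicz N μ) :
    ‖f‖ = luxNorm N μ f.1 := rfl

instance (N : YoungFunction) (μ : Measure α) : NormedSpace ℝ (Orlicz N μ) where
  norm_smul_le c f := luxNorm_smul_le N c f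

end Orlicz

/-- `N` is `Δ₂`-regular with respect to `μ`: `N(2s) ≤ c (N(s) + 1_{μ(E) < ∞})`. -/
def DeltaTwo {α : Type*} [MeasurableSpace α] (N : YoungFunction) (μ : Measure α) : Prop :=
  ∃ c : ℝ, 0 < c ∧ ∀ s : ℝ, N (2 * s) ≤ c * (N s + if μ univ < ∞ then 1 else 0)

section Form

variable {E : Type*} [MeasurableSpace E] {m : Measure E}

/-- `L` is a negative definite self-adjoint (unbounded) operator on `L²(m)` with `Ker L = {0}`. -/
structure IsNegSelfAdjoint (L : Lp ℝ 2 m →ₗ.[ℝ] Lp ℝ 2 m) : Prop where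
  selfAdjoint : IsSelfAdjoint L
  nonpos : ∀ u : L.domain, inner ℝ (L u) (u : Lp ℝ 2 m) ≤ 0
  ker_eq : ∀ u : L.domain, L u = 0 → u = 0

/-- `S = √(-L)`: the nonnegative self-adjoint operator with `S ∘ S = -L`. -/
structure IsSqrtNeg (S L : Lp ℝ 2 m →ₗ.[ℝ] Lp ℝ 2 m) : Prop where
  selfAdjoint : IsSelfAdjoint S
  nonneg : ∀ u : S.domain, 0 ≤ inner ℝ (S u) (u : Lp ℝ 2 m)
  sq_eq : ∀ u w : Lp ℝ 2 m,
    (u, w) ∈ L.graph ↔ ∃ y : Lp ℝ 2 m, (u, y) ∈ S.graph ∧ (y, -w) ∈ S.graph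

/-- `D(𝓔) = D(√(-L))`, as a space of its own, to carry the norm `𝓔(u,u)^{1/2}`. -/
def FormDomain (S : Lp ℝ 2 m →ₗ.[ℝ] Lp ℝ 2 m) : Type _ := S.domain

namespace FormDomain

variable (S : Lp ℝ 2 m →ₗ.[ℝ] Lp ℝ 2 m)

instance : AddCommGroup (FormDomain S) := inferInstanceAs (AddCommGroup S.domain)

instance : Module ℝ (FormDomain S) := inferInstanceAs (Module ℝ S.domain)

/-- The linear map `u ↦ √(-L) u` on `D(𝓔)`. -/
def op : FormDomain S →ₗ[ℝ] Lp ℝ 2 m := S.toFun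

/-- The element of `L²(m)` underlying an element of `D(𝓔)`. -/
def toL2 : FormDomain S →ₗ[ℝ] Lp ℝ 2 m := S.domain.subtype

instance : SeminormedAddCommGroup (FormDomain S) :=
  SeminormedAddCommGroup.induced (FormDomain S) (Lp ℝ 2 m) (op S)

/-- The form `𝓔(u,v) = m(√(-L)u √(-L)v)`. -/
instance : InnerProductSpace ℝ (FormDomain S) where
  inner u v := inner ℝ (op S u) (op S v)
  norm_smul_le c u := by
    change ‖op S (c • u)‖ ≤ ‖c‖ * ‖op S u‖
    rw [map_smul, norm_smul]
  norm_sq_eq_re_inner u := by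
    change ‖op S u‖ ^ 2 = RCLike.re (inner ℝ (op S u) (op S u))
    exact InnerProductSpace.norm_sq_eq_re_inner _
  conj_inner_symm u v := InnerProductSpace.conj_inner_symm _ _
  add_left u v w := by
    change inner ℝ (op S (u + v)) (op S w) = _
    rw [map_add, inner_add_left]
  smul_left u v c := by
    change inner ℝ (op S (c • u)) (op S v) = _
    rw [map_smul, inner_smul_left]

end FormDomain

/-- `𝓕_e`, the abstract completion of `D(𝓔)` with respect to `𝓔^{1/2}`. -/
def Fe (S : Lp ℝ 2 m →ₗ.[ℝ] Lp ℝ 2 m) : Type _ := UniformSpace.Completion (FormDomain S)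

namespace Fe

variable (S : Lp ℝ 2 m →ₗ.[ℝ] Lp ℝ 2 m)

instance : NormedAddCommGroup (Fe S) :=
  inferInstanceAs (NormedAddCommGroup (UniformSpace.Completion (FormDomain S)))

instance : InnerProductSpace ℝ (Fe S) :=
  inferInstanceAs (InnerProductSpace ℝ (UniformSpace.Completion (FormDomain S)))

instance : CompleteSpace (Fe S) :=
  inferInstanceAs (CompleteSpace (UniformSpace.Completion (FormDomain S)))

/-- The canonical isometric map `D(𝓔) → 𝓕_e`. -/
def of : FormDomain S →ₗᵢ[ℝ] Fe S :=
  (UniformSpace.Completion.toComplₗᵢ : FormDomain S →ₗᵢ[ℝ] UniformSpace.Completion (FormDomain S))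

theorem denseRange_of : DenseRange (of S) :=
  UniformSpace.Completion.denseRange_coe (α := FormDomain S)

end Fe

/-- `H = 𝓕_e^*`, with the dual norm. -/
abbrev GreenSpace (S : Lp ℝ 2 m →ₗ.[ℝ] Lp ℝ 2 m) : Type _ := StrongDual ℝ (Fe S)

/-- The inner product of `H = 𝓕_e^*` induced by the Riesz isomorphism `𝓕_e ≃ 𝓕_e^*`. -/
instance (S : Lp ℝ 2 m →ₗ.[ℝ] Lp ℝ 2 m) : InnerProductSpace ℝ (GreenSpace S) where
  inner a b := inner ℝ ((InnerProductSpace.toDual ℝ (Fe S)).symm a)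
    ((InnerProductSpace.toDual ℝ (Fe S)).symm b)
  norm_sq_eq_re_inner a := by
    rw [← InnerProductSpace.norm_sq_eq_re_inner, LinearIsometryEquiv.norm_map]
  conj_inner_symm _ _ := InnerProductSpace.conj_inner_symm _ _
  add_left a b c := by
    rw [map_add, inner_add_left]
  smul_left a b r := by
    rw [LinearIsometryEquiv.map_smulₛₗ, inner_smul_left]; simp

end Form

section Spaces

variable {E : Type*} [MeasurableSpace E] {m : Measure E}

theorem integrable_mul_of_orlicz (N : YoungFunction) {f g : E →ₘ[m] ℝ}
    (hf : f ∈ Orlicz N m) (hg : g ∈ Orlicz N.dual m) : Integrable (fun e => f e * g e) m := by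
  obtain ⟨a, ha, hfa⟩ := hf
  obtain ⟨b, hb, hgb⟩ := hg
  have hi : ∀ (M : YoungFunction) (c : ℝ) (k : E →ₘ[m] ℝ), modular M m (fun x => c * k x) < ∞ →
      Integrable (fun x => M (c * k x)) m := fun M c k hk => by
    refine ⟨(M.continuous'.measurable.comp_aemeasurable
      (k.aestronglyMeasurable.aemeasurable.const_mul c)).aestronglyMeasurable, ?_⟩
    rw [hasFiniteIntegral_iff_ofReal (Eventually.of_forall fun x => M.nonneg' _)]
    exact hk
  have h := ((hi N a f hfa).add (hi N.dual b g hgb)).const_mul (1 / (a * b))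
  refine h.mono' (f.aestronglyMeasurable.mul g.aestronglyMeasurable) (Eventually.of_forall fun x => ?_)
  have h1 := N.le_dualFun (abs_nonneg (a * f x)) (b * g x)
  rw [N.abs_eq] at h1
  have h2 : |a * f x| * |b * g x| = a * b * |f x * g x| := by
    simp only [abs_mul, abs_of_pos ha, abs_of_pos hb]; ring
  simp only [Pi.add_apply, Real.norm_eq_abs]
  rw [one_div, ← div_eq_inv_mul, le_div_iff₀ (by positivity)]
  change |f x * g x| * (a * b) ≤ N (a * f x) + N.dualFun (b * g x)
  linarith

/-- Condition (L1), for the inclusion map `J` of `𝓕_e` into the measurable functions: `J` is the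
identity on `D(𝓔)`, it is injective, and it maps `𝓕_e` continuously into `L¹(g·m)` for a strictly
positive `g ∈ L¹(m) ∩ L^∞(m)`. By density of `D(𝓔)` in `𝓕_e` there is at most one such `J`. -/
structure CondL1 (S : Lp ℝ 2 m →ₗ.[ℝ] Lp ℝ 2 m) (J : Fe S →ₗ[ℝ] (E →ₘ[m] ℝ)) : Prop where
  eq_self : ∀ u : FormDomain S,
    J (Fe.of S u) = ((FormDomain.toL2 S u : Lp ℝ 2 m) : E →ₘ[m] ℝ)
  injective : Function.Injective J
  continuous : ∃ g : E → ℝ, (∀ e, 0 < g e) ∧ Integrable g m ∧ MemLp g ∞ m ∧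
    ∃ C : ℝ, ∀ x : Fe S,
      Integrable (fun e => |J x e| * g e) m ∧ ∫ e, |J x e| * g e ∂m ≤ C * ‖x‖

/-- `V = H ∩ L_N(m)`. An element is `u ∈ L_N(m)` together with the functional `ū ∈ H = 𝓕_e^*` that
satisfies `ū(x) = m(u x)` for all `x ∈ 𝓕_e ∩ L_{N*}`. Such a `ū` exists if and only if
`m(u x) ≤ c ‖x‖` on `𝓕_e ∩ L_{N*}` for some `c` (`VSpace.exists_toLN_eq_iff`), and it is unique if
`𝓕_e ∩ L_{N*}` is dense in `𝓕_e`. -/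
def VSub (N : YoungFunction) (S : Lp ℝ 2 m →ₗ.[ℝ] Lp ℝ 2 m) (J : Fe S →ₗ[ℝ] (E →ₘ[m] ℝ)) :
    Submodule ℝ (Orlicz N m × GreenSpace S) where
  carrier := {v | ∀ x : Fe S, J x ∈ Orlicz N.dual m → v.2 x = ∫ e, v.1.1 e * J x e ∂m}
  zero_mem' := by
    intro x _
    rw [integral_eq_zero_of_ae]
    · rfl
    · filter_upwards [AEEqFun.coeFn_zero (μ := m) (β := ℝ)] with e he
      change (0 : E →ₘ[m] ℝ) e * J x e = 0
      rw [he]; simp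
  add_mem' := by
    intro v w hv hw x hx
    have h : ∫ e, (v + w).1.1 e * J x e ∂m =
        ∫ e, (v.1.1 e * J x e + w.1.1 e * J x e) ∂m := by
      refine integral_congr_ae ?_
      filter_upwards [AEEqFun.coeFn_add v.1.1 w.1.1] with e he
      change (v.1.1 + w.1.1) e * J x e = _
      rw [he, Pi.add_apply, add_mul]
    rw [h, integral_add (integrable_mul_of_orlicz N v.1.2 hx)
      (integrable_mul_of_orlicz N w.1.2 hx), ← hv x hx, ← hw x hx]
    rfl
  smul_mem' := by
    intro c v hv x hx
    have h : ∫ e, (c • v).1.1 e * J x e ∂m = ∫ e, c * (v.1.1 e * J x e) ∂m := by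
      refine integral_congr_ae ?_
      filter_upwards [AEEqFun.coeFn_smul c v.1.1] with e he
      change (c • v.1.1) e * J x e = _
      rw [he, Pi.smul_apply, smul_eq_mul, mul_assoc]
    rw [h, integral_const_mul, ← hv x hx]
    rfl

/-- The space `V`, with the norm `‖u‖_V = ‖u‖_{L_N} + ‖ū‖_H`. -/
def VSpace (N : YoungFunction) (S : Lp ℝ 2 m →ₗ.[ℝ] Lp ℝ 2 m) (J : Fe S →ₗ[ℝ] (E →ₘ[m] ℝ)) :
    Type _ := VSub N S J

namespace VSpace

instance (N : YoungFunction) (S : Lp ℝ 2 m →ₗ.[ℝ] Lp ℝ 2 m) (J : Fe S →ₗ[ℝ] (E →ₘ[m] ℝ)) : AddCommGroup (VSpace N S J) :=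
  inferInstanceAs (AddCommGroup (VSub N S J))

instance (N : YoungFunction) (S : Lp ℝ 2 m →ₗ.[ℝ] Lp ℝ 2 m) (J : Fe S →ₗ[ℝ] (E →ₘ[m] ℝ)) : Module ℝ (VSpace N S J) :=
  inferInstanceAs (Module ℝ (VSub N S J))

instance (N : YoungFunction) (S : Lp ℝ 2 m →ₗ.[ℝ] Lp ℝ 2 m) (J : Fe S →ₗ[ℝ] (E →ₘ[m] ℝ)) : NormedAddCommGroup (VSpace N S J) :=
  AddGroupNorm.toNormedAddCommGroup
    { toFun := fun v => ‖v.1.1‖ + ‖v.1.2‖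
      map_zero' := by
        have h1 : ‖(0 : Orlicz N m)‖ = 0 := norm_zero
        have h2 : ‖(0 : GreenSpace S)‖ = 0 := norm_zero
        have h3 := congrArg₂ (· + ·) h1 h2
        rw [add_zero] at h3
        exact h3
      add_le' := fun v w => by
        have h1 : ‖v.1.1 + w.1.1‖ ≤ _ := norm_add_le _ _
        have h2 : ‖v.1.2 + w.1.2‖ ≤ _ := norm_add_le _ _
        have h3 := add_le_add h1 h2
        rw [add_add_add_comm] at h3
        exact h3
      neg' := fun v => by
        have h1 : ‖-v.1.1‖ = _ := norm_neg _
        have h2 : ‖-v.1.2‖ = _ := norm_neg _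
        exact congrArg₂ (· + ·) h1 h2
      eq_zero_of_map_eq_zero' := fun v h => by
        obtain ⟨h1, h2⟩ := (add_eq_zero_iff_of_nonneg (norm_nonneg _) (norm_nonneg _)).1 h
        exact Subtype.ext (Prod.ext (norm_eq_zero.1 h1) (norm_eq_zero.1 h2)) }

instance (N : YoungFunction) (S : Lp ℝ 2 m →ₗ.[ℝ] Lp ℝ 2 m) (J : Fe S →ₗ[ℝ] (E →ₘ[m] ℝ)) : NormedSpace ℝ (VSpace N S J) where
  norm_smul_le c v := by
    have h1 : ‖c • v.1.1‖ = _ := norm_smul c v.1.1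
    have h2 : ‖c • v.1.2‖ = _ := norm_smul c v.1.2
    have h3 := congrArg₂ (· + ·) h1 h2
    simp only [← mul_add] at h3
    exact h3.le

variable {N : YoungFunction} {S : Lp ℝ 2 m →ₗ.[ℝ] Lp ℝ 2 m} {J : Fe S →ₗ[ℝ] (E →ₘ[m] ℝ)}

/-- The inclusion `V ⊂ L_N(m)`. -/
def toLN (v : VSpace N S J) : Orlicz N m := v.1.1

/-- The inclusion `V ⊂ H`, `u ↦ ū`. -/
def toH : VSpace N S J →L[ℝ] GreenSpace S :=
  LinearMap.mkContinuous
    { toFun := fun v : VSpace N S J => (v.1.2 : GreenSpace S)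
      map_add' := fun _ _ => rfl
      map_smul' := fun _ _ => rfl } 1
    (fun v => by
      change ‖v.1.2‖ ≤ 1 * (‖v.1.1‖ + ‖v.1.2‖)
      linarith [norm_nonneg v.1.1])

theorem norm_eq_add (v : VSpace N S J) : ‖v‖ = ‖toLN v‖ + ‖toH v‖ :=
  rfl

theorem toH_apply (v : VSpace N S J) {x : Fe S} (hx : J x ∈ Orlicz N.dual m) :
    toH v x = ∫ e, (toLN v).1 e * J x e ∂m := v.2 x hx

theorem exists_toLN_eq_iff (u : Orlicz N m) : (∃ v : VSpace N S J, toLN v = u) ↔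
    ∃ c : ℝ, 0 < c ∧ ∀ x : Fe S, J x ∈ Orlicz N.dual m → ∫ e, u.1 e * J x e ∂m ≤ c * ‖x‖ := by
  constructor
  · rintro ⟨v, rfl⟩
    refine ⟨‖toH v‖ + 1, by positivity, fun x hx => ?_⟩
    rw [← toH_apply v hx]
    have := (le_abs_self _).trans ((toH v).le_opNorm x)
    nlinarith [norm_nonneg x]
  · rintro ⟨c, hc, h⟩
    let D : Submodule ℝ (Fe S) := (Orlicz N.dual m).comap J
    let φ : D →ₗ[ℝ] ℝ :=
      { toFun := fun x => ∫ e, u.1 e * J x.1 e ∂m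
        map_add' := fun x y => by
          rw [← integral_add (integrable_mul_of_orlicz N u.2 x.2)
            (integrable_mul_of_orlicz N u.2 y.2)]
          refine integral_congr_ae ?_
          filter_upwards [AEEqFun.coeFn_add (J x.1) (J y.1)] with e he
          rw [Submodule.coe_add, map_add, he, Pi.add_apply, mul_add]
        map_smul' := fun r x => by
          rw [RingHom.id_apply, smul_eq_mul, ← integral_const_mul]
          refine integral_congr_ae ?_
          filter_upwards [AEEqFun.coeFn_smul r (J x.1)] with e he
          rw [Submodule.coe_smul, map_smul, he, Pi.smul_apply, smul_eq_mul]; ring }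
    have hφ : ∀ x : D, ‖φ x‖ ≤ c * ‖x‖ := fun x => by
      rw [Real.norm_eq_abs, abs_le]
      constructor
      · have h1 : φ (-x) ≤ c * ‖-x‖ := h _ (-x).2
        rw [map_neg, norm_neg] at h1
        linarith
      · exact h _ x.2
    obtain ⟨ψ, hψ, -⟩ := exists_extension_norm_eq D (φ.mkContinuous c hφ)
    exact ⟨⟨(u, ψ), fun x hx => hψ ⟨x, hx⟩⟩, rfl⟩

theorem toLN_injective (h : Dense {x : Fe S | J x ∈ Orlicz N.dual m}) :
    Function.Injective (toLN : VSpace N S J → Orlicz N m) := by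
  intro v w hvw
  have hH : toH v = toH w := by
    refine ContinuousLinearMap.ext fun x => ?_
    refine congrFun (Continuous.ext_on h (toH v).continuous (toH w).continuous fun y hy => ?_) x
    rw [toH_apply v hy, toH_apply w hy, hvw]
  exact Subtype.ext (Prod.ext hvw hH)

end VSpace

/-- Condition (N1): `𝓕_e ∩ L_{N*}` is dense in `𝓕_e` and in `L_{N*}`. -/
structure CondN1 (N : YoungFunction) (S : Lp ℝ 2 m →ₗ.[ℝ] Lp ℝ 2 m)
    (J : Fe S →ₗ[ℝ] (E →ₘ[m] ℝ)) : Prop where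
  dense_Fe : Dense {x : Fe S | J x ∈ Orlicz N.dual m}
  dense_dual : Dense {w : Orlicz N.dual m | ∃ x : Fe S, J x = w.1}

/-- Condition (N2): `V` is dense in `H` and in `L_N`. -/
structure CondN2 (N : YoungFunction) (S : Lp ℝ 2 m →ₗ.[ℝ] Lp ℝ 2 m)
    (J : Fe S →ₗ[ℝ] (E →ₘ[m] ℝ)) : Prop where
  dense_H : DenseRange (VSpace.toH : VSpace N S J → GreenSpace S)
  dense_LN : DenseRange (VSpace.toLN : VSpace N S J → Orlicz N m)

/-- The embedding `H ⊂ V^*`: `a ∈ H` acts on `V` by `v ↦ ⟨a, v⟩_H`. -/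
def hToVDual (N : YoungFunction) (S : Lp ℝ 2 m →ₗ.[ℝ] Lp ℝ 2 m) (J : Fe S →ₗ[ℝ] (E →ₘ[m] ℝ))
    (a : GreenSpace S) : StrongDual ℝ (VSpace N S J) :=
  (innerSL ℝ a).comp VSpace.toH

/-- `L̄ : 𝓕_e → 𝓕_e^*`, `L̄ x = -𝓔(x, ·)`. -/
def LbarFe (S : Lp ℝ 2 m →ₗ.[ℝ] Lp ℝ 2 m) (x : Fe S) : GreenSpace S := -innerSL ℝ x

/-- `Λ : L_{N*} → V^*` is a continuous linear extension of
`L̄ : 𝓕_e ∩ L_{N*} → 𝓕_e^* ⊂ V^*`. -/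
def ExtendsLbar {N : YoungFunction} {S : Lp ℝ 2 m →ₗ.[ℝ] Lp ℝ 2 m} {J : Fe S →ₗ[ℝ] (E →ₘ[m] ℝ)}
    (Λ : Orlicz N.dual m →L[ℝ] StrongDual ℝ (VSpace N S J)) : Prop :=
  ∀ (x : Fe S) (w : Orlicz N.dual m), J x = w.1 → Λ w = hToVDual N S J (LbarFe S x)

/-- `R(v) = m(N(v)) + ‖v‖_H²`. -/
def RFun (N : YoungFunction) (S : Lp ℝ 2 m →ₗ.[ℝ] Lp ℝ 2 m) (J : Fe S →ₗ[ℝ] (E →ₘ[m] ℝ))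
    (v : VSpace N S J) : ℝ :=
  ∫ e, N ((VSpace.toLN v).1 e) ∂m + ‖VSpace.toH v‖ ^ 2

/-- The measure `dt × P` on `[0,T] × Ω`. -/
def timeProb {Ω : Type*} [MeasurableSpace Ω] (T : ℝ≥0) (P : Measure Ω) : Measure (ℝ × Ω) :=
  (volume.restrict (Icc (0 : ℝ) T)).prod P

instance {Ω : Type*} [MeasurableSpace Ω] (T : ℝ≥0) (P : Measure Ω) [IsProbabilityMeasure P] :
    IsFiniteMeasure (timeProb T P) := by
  unfold timeProb; infer_instance

/-- `v ∈ V` is the common value at `p = (t, ω)` of `f`, a function on `([0,T] × Ω) × E`, and of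
`φ`, an `H`-valued function on `[0,T] × Ω`. -/
def IsSlice {Ω : Type*} {N : YoungFunction} {S : Lp ℝ 2 m →ₗ.[ℝ] Lp ℝ 2 m}
    {J : Fe S →ₗ[ℝ] (E →ₘ[m] ℝ)} (f : (ℝ × Ω) × E → ℝ) (φ : ℝ × Ω → GreenSpace S) (p : ℝ × Ω)
    (v : VSpace N S J) : Prop :=
  (VSpace.toLN v).1 =ᵐ[m] (fun e => f (p, e)) ∧ VSpace.toH v = φ p

/-- `K = L_N([0,T] × E × Ω; dt × m × P) ∩ L²([0,T] × Ω → H; dt × P)`: the pairs of `f` in the first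
and `φ` in the second space such that, for a.e. `(t, ω)`, `f(t, ·, ω)` belongs to `V` and equals
`φ(t, ω)` as an element of `H`. The coordinates are ordered as `((t, ω), e)`. -/
def KSub {Ω : Type*} [MeasurableSpace Ω] (N : YoungFunction) (S : Lp ℝ 2 m →ₗ.[ℝ] Lp ℝ 2 m)
    (J : Fe S →ₗ[ℝ] (E →ₘ[m] ℝ)) [SFinite m] (T : ℝ≥0) (P : Measure Ω) :
    Submodule ℝ (Orlicz N ((timeProb T P).prod m) × Lp (GreenSpace S) 2 (timeProb T P)) where
  carrier := {z | ∀ᵐ p ∂(timeProb T P), ∃ v : VSpace N S J, IsSlice z.1.1 z.2 p v}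
  zero_mem' := by
    change ∀ᵐ p ∂(timeProb T P), _
    have h1 : ∀ᵐ p ∂(timeProb T P), ∀ᵐ e ∂m,
        (0 : (ℝ × Ω) × E →ₘ[(timeProb T P).prod m] ℝ) (p, e) = 0 :=
      Measure.ae_ae_of_ae_prod AEEqFun.coeFn_zero
    filter_upwards [h1, Lp.coeFn_zero (GreenSpace S) 2 (timeProb T P)] with p hp hq
    refine ⟨0, ?_, ?_⟩
    · filter_upwards [hp, AEEqFun.coeFn_zero (μ := m) (β := ℝ)] with e he h0
      change (0 : E →ₘ[m] ℝ) e = (0 : (ℝ × Ω) × E →ₘ[(timeProb T P).prod m] ℝ) (p, e)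
      rw [he, h0]; rfl
    · change (0 : GreenSpace S) = (0 : Lp (GreenSpace S) 2 (timeProb T P)) p
      rw [hq]; rfl
  add_mem' := by
    intro z w hz hw
    change ∀ᵐ p ∂(timeProb T P), _
    have h1 : ∀ᵐ p ∂(timeProb T P), ∀ᵐ e ∂m,
        (z.1.1 + w.1.1) (p, e) = z.1.1 (p, e) + w.1.1 (p, e) :=
      Measure.ae_ae_of_ae_prod (AEEqFun.coeFn_add z.1.1 w.1.1)
    filter_upwards [h1, Lp.coeFn_add z.2 w.2, hz, hw] with p hp hq ⟨v, hv⟩ ⟨v', hv'⟩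
    refine ⟨v + v', ?_, ?_⟩
    · filter_upwards [hp, hv.1, hv'.1, AEEqFun.coeFn_add (VSpace.toLN v).1 (VSpace.toLN v').1]
        with e he h2 h3 h4
      change ((VSpace.toLN v).1 + (VSpace.toLN v').1) e = (z.1.1 + w.1.1) (p, e)
      rw [he, h4, Pi.add_apply, h2, h3]
    · change _ = (z.2 + w.2) p
      rw [hq, Pi.add_apply, map_add, hv.2, hv'.2]
  smul_mem' := by
    intro c z hz
    change ∀ᵐ p ∂(timeProb T P), _
    have h1 : ∀ᵐ p ∂(timeProb T P), ∀ᵐ e ∂m, (c • z.1.1) (p, e) = c • z.1.1 (p, e) :=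
      Measure.ae_ae_of_ae_prod (AEEqFun.coeFn_smul c z.1.1)
    filter_upwards [h1, Lp.coeFn_smul c z.2, hz] with p hp hq ⟨v, hv⟩
    refine ⟨c • v, ?_, ?_⟩
    · filter_upwards [hp, hv.1, AEEqFun.coeFn_smul c (VSpace.toLN v).1] with e he h2 h4
      change (c • (VSpace.toLN v).1) e = (c • z.1.1) (p, e)
      rw [he, h4, Pi.smul_apply, h2]
    · change _ = (c • z.2) p
      rw [hq, Pi.smul_apply, map_smul, hv.2]

/-- The space `K`, with the norm `‖f‖_{L_N} + ‖φ‖_{L²}`. -/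
def KSpace {Ω : Type*} [MeasurableSpace Ω] (N : YoungFunction) (S : Lp ℝ 2 m →ₗ.[ℝ] Lp ℝ 2 m)
    (J : Fe S →ₗ[ℝ] (E →ₘ[m] ℝ)) [SFinite m] (T : ℝ≥0) (P : Measure Ω) : Type _ :=
  KSub N S J T P

namespace KSpace

instance {Ω : Type*} [MeasurableSpace Ω] (N : YoungFunction)
    (S : Lp ℝ 2 m →ₗ.[ℝ] Lp ℝ 2 m) (J : Fe S →ₗ[ℝ] (E →ₘ[m] ℝ)) [SFinite m] (T : ℝ≥0)
    (P : Measure Ω) : AddCommGroup (KSpace N S J T P) :=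
  inferInstanceAs (AddCommGroup (KSub N S J T P))

instance {Ω : Type*} [MeasurableSpace Ω] (N : YoungFunction)
    (S : Lp ℝ 2 m →ₗ.[ℝ] Lp ℝ 2 m) (J : Fe S →ₗ[ℝ] (E →ₘ[m] ℝ)) [SFinite m] (T : ℝ≥0)
    (P : Measure Ω) : Module ℝ (KSpace N S J T P) :=
  inferInstanceAs (Module ℝ (KSub N S J T P))

instance {Ω : Type*} [MeasurableSpace Ω] (N : YoungFunction)
    (S : Lp ℝ 2 m →ₗ.[ℝ] Lp ℝ 2 m) (J : Fe S →ₗ[ℝ] (E →ₘ[m] ℝ)) [SFinite m] (T : ℝ≥0)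
    (P : Measure Ω) : NormedAddCommGroup (KSpace N S J T P) :=
  AddGroupNorm.toNormedAddCommGroup
    { toFun := fun v => ‖v.1.1‖ + ‖v.1.2‖
      map_zero' := by
        have h1 : ‖(0 : Orlicz N ((timeProb T P).prod m))‖ = 0 := norm_zero
        have h2 : ‖(0 : Lp (GreenSpace S) 2 (timeProb T P))‖ = 0 := norm_zero
        have h3 := congrArg₂ (· + ·) h1 h2
        rw [add_zero] at h3
        exact h3
      add_le' := fun v w => by
        have h1 : ‖v.1.1 + w.1.1‖ ≤ _ := norm_add_le _ _
        have h2 : ‖v.1.2 + w.1.2‖ ≤ _ := norm_add_le _ _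
        have h3 := add_le_add h1 h2
        rw [add_add_add_comm] at h3
        exact h3
      neg' := fun v => by
        have h1 : ‖-v.1.1‖ = _ := norm_neg _
        have h2 : ‖-v.1.2‖ = _ := norm_neg _
        exact congrArg₂ (· + ·) h1 h2
      eq_zero_of_map_eq_zero' := fun v h => by
        obtain ⟨h1, h2⟩ := (add_eq_zero_iff_of_nonneg (norm_nonneg _) (norm_nonneg _)).1 h
        exact Subtype.ext (Prod.ext (norm_eq_zero.1 h1) (norm_eq_zero.1 h2)) }

instance {Ω : Type*} [MeasurableSpace Ω] (N : YoungFunction)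
    (S : Lp ℝ 2 m →ₗ.[ℝ] Lp ℝ 2 m) (J : Fe S →ₗ[ℝ] (E →ₘ[m] ℝ)) [SFinite m] (T : ℝ≥0)
    (P : Measure Ω) : NormedSpace ℝ (KSpace N S J T P) where
  norm_smul_le c v := by
    have h1 : ‖c • v.1.1‖ = _ := norm_smul c v.1.1
    have h2 : ‖c • v.1.2‖ = _ := norm_smul c v.1.2
    have h3 := congrArg₂ (· + ·) h1 h2
    simp only [← mul_add] at h3
    exact h3.le

variable {Ω : Type*} [MeasurableSpace Ω] {N : YoungFunction} {S : Lp ℝ 2 m →ₗ.[ℝ] Lp ℝ 2 m}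
  {J : Fe S →ₗ[ℝ] (E →ₘ[m] ℝ)} [SFinite m] {T : ℝ≥0} {P : Measure Ω}

theorem norm_eq_add (z : KSpace N S J T P) : ‖z‖ = ‖z.1.1‖ + ‖z.1.2‖ :=
  rfl

open Classical in
/-- A `dt × P`-version `(t, ω) ↦ z_t(ω) ∈ V` of `z ∈ K`. -/
def eval (z : KSpace N S J T P) (p : ℝ × Ω) : VSpace N S J :=
  if h : ∃ v : VSpace N S J, IsSlice z.1.1.1 z.1.2 p v then h.choose else 0

theorem isSlice_eval (z : KSpace N S J T P) :
    ∀ᵐ p ∂(timeProb T P), IsSlice z.1.1.1 z.1.2 p (eval z p) := by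
  filter_upwards [z.2] with p hp
  rw [eval, dif_pos hp]
  exact hp.choose_spec

end KSpace

end Spaces

section HilbertSchmidt

variable {ι G H : Type*} [NormedAddCommGroup G] [InnerProductSpace ℝ G]
  [NormedAddCommGroup H] [NormedSpace ℝ H]

/-- The Hilbert-Schmidt operators `G → H`: `∑ᵢ ‖B gᵢ‖² < ∞` for the orthonormal basis `(gᵢ)`. -/
def HSOp (b : HilbertBasis ι ℝ G) (H : Type*) [NormedAddCommGroup H] [NormedSpace ℝ H] :
    Submodule ℝ (G →L[ℝ] H) where
  carrier := {B | Memℓp (fun i => B (b i)) 2}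
  zero_mem' := zero_memℓp
  add_mem' h k := h.add k
  smul_mem' c _ h := h.const_smul c

/-- The isometric embedding `B ↦ (B gᵢ)ᵢ` into `ℓ²(H)`, which gives the Hilbert-Schmidt norm. -/
def HSOp.toLp (b : HilbertBasis ι ℝ G) : HSOp b H →ₗ[ℝ] lp (fun _ : ι => H) 2 where
  toFun B := ⟨fun i => B.1 (b i), B.2⟩
  map_add' _ _ := rfl
  map_smul' _ _ := rfl

theorem HSOp.toLp_injective (b : HilbertBasis ι ℝ G) :
    Function.Injective (HSOp.toLp (H := H) b) := by
  intro A B h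
  have h' : ∀ i, A.1 (b i) = B.1 (b i) := fun i => congrFun (congrArg Subtype.val h) i
  refine Subtype.ext (ContinuousLinearMap.ext_on (s := range b) ?_ ?_)
  · rw [dense_iff_closure_eq, ← Submodule.topologicalClosure_coe, b.dense_span]; rfl
  · rintro _ ⟨i, rfl⟩; exact h' i

/-- `L_HS(G; H)` with the Hilbert-Schmidt norm. -/
def HS (b : HilbertBasis ι ℝ G) (H : Type*) [NormedAddCommGroup H] [NormedSpace ℝ H] : Type _ :=
  HSOp b H

instance (b : HilbertBasis ι ℝ G) : AddCommGroup (HS b H) :=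
  inferInstanceAs (AddCommGroup (HSOp b H))

instance (b : HilbertBasis ι ℝ G) : NormedAddCommGroup (HS b H) :=
  NormedAddCommGroup.induced (HS b H) (lp (fun _ : ι => H) 2)
    (HSOp.toLp b : HSOp b H →ₗ[ℝ] lp (fun _ : ι => H) 2) (HSOp.toLp_injective b)

theorem HS.norm_sq_eq (b : HilbertBasis ι ℝ G) (B : HS b H) :
    ‖B‖ ^ 2 = ∑' i, ‖(B : HSOp b H).1 (b i)‖ ^ 2 := by
  have h := lp.norm_rpow_eq_tsum (p := 2) (by norm_num)
    (HSOp.toLp b (B : HSOp b H) : lp (fun _ : ι => H) 2)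
  simp only [ENNReal.toReal_ofNat, Real.rpow_ofNat] at h
  exact h

end HilbertSchmidt

section Abstract

variable {Ω : Type*} {mΩ : MeasurableSpace Ω}

/-- `X`, restricted to `[0,t] × Y × Ω`, is measurable with respect to `ℬ([0,t]) ⊗ ℬ(Y) ⊗ ℱ_t`. -/
def ProgMeasAt {Y Z : Type*} [TopologicalSpace Y] [TopologicalSpace Z] (ℱ : Filtration ℝ≥0 mΩ)
    (t : ℝ≥0) (X : ℝ → Y → Ω → Z) : Prop :=
  @Measurable (Icc (0 : ℝ) t × Y × Ω) Z
    (@Prod.instMeasurableSpace _ _ inferInstance (@Prod.instMeasurableSpace _ _ (borel Y) (ℱ t)))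
    (borel Z) (fun q => X q.1 q.2.1 q.2.2)

/-- `f_t` is `ℱ_t`-measurable for every `t ∈ [0,T]`. -/
def AdaptedOn (ℱ : Filtration ℝ≥0 mΩ) (T : ℝ≥0) (f : ℝ → Ω → ℝ) : Prop :=
  ∀ t : ℝ≥0, t ≤ T → Measurable[ℱ t] (f t)

/-- `f` is adapted and `f ∈ L¹([0,T] × Ω; dt × P)`. -/
def AdaptedL1 (ℱ : Filtration ℝ≥0 mΩ) (P : Measure Ω) (T : ℝ≥0) (f : ℝ → Ω → ℝ) : Prop :=
  AdaptedOn ℱ T f ∧ Integrable (fun p : ℝ × Ω => f p.1 p.2) (timeProb T P)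

/-- `f` is locally bounded on `[0,∞)` and tends to `∞` at `∞`. -/
def LocBddToInfty (W : ℝ → ℝ) : Prop :=
  (∀ r : ℝ, ∃ C : ℝ, ∀ s ∈ Icc 0 r, |W s| ≤ C) ∧ Tendsto W atTop atTop

variable {V H 𝓚 𝓛 : Type*} [NormedAddCommGroup V] [NormedSpace ℝ V] [NormedAddCommGroup H]
  [NormedSpace ℝ H] [NormedAddCommGroup 𝓚] [NormedAddCommGroup 𝓛]

/-- `𝔼 ∫₀ᵀ R(z_t) dt`, possibly infinite, for a `V`-valued `z` and `μ = dt × P`. -/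
def meanR (μ : Measure (ℝ × Ω)) (R : V → ℝ) (z : ℝ × Ω → V) : ℝ≥0∞ :=
  ∫⁻ p, ENNReal.ofReal (R (z p)) ∂μ

/-- Condition (K), for `μ = dt × P` on `[0,T] × Ω`, a normed space `𝓚` of (classes of) functions
`[0,T] × Ω → V`, where `ev z` is a version of `z ∈ 𝓚`, and a function `R` on `V`. -/
structure CondK (μ : Measure (ℝ × Ω)) (ev : 𝓚 → ℝ × Ω → V) (R : V → ℝ) : Prop where
  continuous : Continuous R
  nonneg : ∀ v, 0 ≤ R v
  symm : ∀ v, R v = R (-v)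
  zero : R 0 = 0
  tendsto_iff : ∀ z : ℕ → 𝓚,
    Tendsto (fun n => ‖z n‖) atTop (𝓝 0) ↔ Tendsto (fun n => meanR μ R (ev (z n))) atTop (𝓝 0)
  bounds : ∃ W₁ W₂ : ℝ → ℝ, LocBddToInfty W₁ ∧ LocBddToInfty W₂ ∧ ∀ z : 𝓚,
    meanR μ R (ev z) < ∞ ∧ W₁ (meanR μ R (ev z)).toReal ≤ ‖z‖ ∧
      ‖z‖ ≤ W₂ (meanR μ R (ev z)).toReal
  add_le : ∃ C : ℝ, 0 < C ∧ ∀ x y : V, R (x + y) ≤ C * (R ((2 : ℝ) • x) + R ((2 : ℝ) • y))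
  mul_mem : ∀ h : ℝ × Ω → ℝ, MemLp h ∞ μ → ∀ z : 𝓚,
    ∃ y : 𝓚, (∀ᵐ p ∂μ, ev y p = h p • ev z p) ∧ ‖y‖ ≤ (eLpNorm h ∞ μ).toReal * ‖z‖

/-- Condition (H1), hemicontinuity. -/
def CondH1 (T : ℝ≥0) (A : ℝ → V → Ω → StrongDual ℝ V) : Prop :=
  ∀ (u v x : V) (ω : Ω), ∀ t ∈ Icc (0 : ℝ) T, Continuous fun r : ℝ => A t (u + r • v) ω x

/-- Condition (H2), weak monotonicity; `j` is the embedding `V ⊂ H`. -/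
def CondH2 (T : ℝ≥0) (j : V →L[ℝ] H) (A : ℝ → V → Ω → StrongDual ℝ V) (B : ℝ → V → Ω → 𝓛) :
    Prop :=
  ∃ c : ℝ, ∀ t ∈ Icc (0 : ℝ) T, ∀ (ω : Ω) (u v : V),
    2 * (A t u ω - A t v ω) (u - v) + ‖B t u ω - B t v ω‖ ^ 2 ≤ c * ‖j (u - v)‖ ^ 2

/-- Condition (H3), coercivity. -/
def CondH3 (ℱ : Filtration ℝ≥0 mΩ) (P : Measure Ω) (T : ℝ≥0) (j : V →L[ℝ] H) (R : V → ℝ)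
    (A : ℝ → V → Ω → StrongDual ℝ V) (B : ℝ → V → Ω → 𝓛) : Prop :=
  ∃ (c₁ c₂ : ℝ) (f : ℝ → Ω → ℝ), 0 < c₁ ∧ 0 < c₂ ∧ AdaptedL1 ℱ P T f ∧
    ∀ t ∈ Icc (0 : ℝ) T, ∀ (ω : Ω) (v : V),
      2 * A t v ω v + ‖B t v ω‖ ^ 2 ≤ c₁ * ‖j v‖ ^ 2 - c₂ * R v + f t ω

/-- Condition (H4), growth. -/
def CondH4 (ℱ : Filtration ℝ≥0 mΩ) (P : Measure Ω) (T : ℝ≥0) (R : V → ℝ)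
    (A : ℝ → V → Ω → StrongDual ℝ V) : Prop :=
  ∃ (c₃ : ℝ) (g : ℝ → Ω → ℝ), 0 < c₃ ∧ AdaptedL1 ℱ P T g ∧
    ∀ t ∈ Icc (0 : ℝ) T, ∀ (ω : Ω) (u v : V), |A t v ω u| ≤ g t ω + c₃ * (R v + R u)

end Abstract

section Coefficients

variable {E : Type*} [MeasurableSpace E] {m : Measure E} {Ω : Type*} {mΩ : MeasurableSpace Ω}

/-- `1_{m(E) < ∞}`. -/
def finInd (m : Measure E) : ℝ := if m univ < ∞ then 1 else 0

/-- `h` is adapted, jointly measurable, and bounded on `[0,T] × Ω`. -/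
structure AdaptedBounded (ℱ : Filtration ℝ≥0 mΩ) (P : Measure Ω) (T : ℝ≥0) (h : ℝ → Ω → ℝ) :
    Prop where
  adapted : AdaptedOn ℱ T h
  measurable : AEStronglyMeasurable (fun p : ℝ × Ω => h p.1 p.2) (timeProb T P)
  bounded : ∃ C : ℝ, ∀ t ∈ Icc (0 : ℝ) T, ∀ ω, |h t ω| ≤ C

/-- Condition (A1); `Φ₀ = Φ - h·id` vanishes in this case. -/
structure CondA1 (ℱ : Filtration ℝ≥0 mΩ) (P : Measure Ω) (T : ℝ≥0) (N : YoungFunction)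
    (m : Measure E) (Ψ Φ : ℝ → ℝ → Ω → ℝ) (h : ℝ → Ω → ℝ) (Φ₀ : ℝ → ℝ → Ω → ℝ) : Prop where
  h_bdd : AdaptedBounded ℱ P T h
  phi_zero : ∀ t ∈ Icc (0 : ℝ) T, ∀ (s : ℝ) (ω : Ω), Φ₀ t s ω = 0
  phi_eq : ∀ t ∈ Icc (0 : ℝ) T, ∀ (s : ℝ) (ω : Ω), Φ t s ω = h t ω * s
  psi : ∃ (f : ℝ → Ω → ℝ) (c : ℝ), AdaptedL1 ℱ P T f ∧
    (∀ t ∈ Icc (0 : ℝ) T, ∀ ω, 0 ≤ f t ω) ∧ 1 ≤ c ∧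
    ∀ t ∈ Icc (0 : ℝ) T, ∀ ω : Ω,
      (∀ s₁ s₂ : ℝ, 0 ≤ (s₂ - s₁) * (Ψ t s₂ ω - Ψ t s₁ ω)) ∧
      (∀ s : ℝ, N s - finInd m * f t ω ≤ s * Ψ t s ω) ∧
      (∀ s : ℝ, s * Ψ t s ω ≤ c * (N s + finInd m * f t ω))
  psi_zero : Integrable (fun p : ℝ × Ω => N.dual (Ψ p.1 0 p.2) * finInd m) (timeProb T P)

instance fact_one_le_add_one (a : ℝ≥0∞) : Fact (1 ≤ a + 1) := ⟨le_add_self⟩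

/-- `Linv : L_N → L_N` is the operator `L^{-1}`: the set `L(D(L) ∩ L_N)` is dense in each
`L^{rᵢ+1}(m)` (that is, its part in `L^{rᵢ+1}(m)` is), `Q i` is the bounded operator on
`L^{rᵢ+1}(m)` that extends the inverse of `L` on this set, and `Linv` is the common restriction
of the `Q i` to `L_N = ⋂ᵢ L^{rᵢ+1}(m)`. -/
structure IsInverse (L : Lp ℝ 2 m →ₗ.[ℝ] Lp ℝ 2 m) (N : YoungFunction) {k : ℕ} (r : Fin k → ℝ≥0)
    (Q : ∀ i, Lp ℝ ((r i : ℝ≥0∞) + 1) m →L[ℝ] Lp ℝ ((r i : ℝ≥0∞) + 1) m)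
    (Linv : Orlicz N m →ₗ[ℝ] Orlicz N m) : Prop where
  dense_range : ∀ i, Dense {w : Lp ℝ ((r i : ℝ≥0∞) + 1) m |
    ∃ u : L.domain, ((u : Lp ℝ 2 m) : E →ₘ[m] ℝ) ∈ Orlicz N m ∧
      (w : E →ₘ[m] ℝ) = (L u : Lp ℝ 2 m)}
  inverse : ∀ (i) (u : L.domain) (w : Lp ℝ ((r i : ℝ≥0∞) + 1) m),
    ((u : Lp ℝ 2 m) : E →ₘ[m] ℝ) ∈ Orlicz N m → (w : E →ₘ[m] ℝ) = (L u : Lp ℝ 2 m) →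
      (Q i w : E →ₘ[m] ℝ) = (u : Lp ℝ 2 m)
  restrict : ∀ (i) (u : Orlicz N m) (w : Lp ℝ ((r i : ℝ≥0∞) + 1) m),
    (w : E →ₘ[m] ℝ) = u.1 → (Q i w : E →ₘ[m] ℝ) = (Linv u).1

/-- Condition (A2), for the splitting `Φ = h·id + Φ₀`. -/
structure CondA2 (ℱ : Filtration ℝ≥0 mΩ) (P : Measure Ω) (T : ℝ≥0) (N : YoungFunction)
    (L : Lp ℝ 2 m →ₗ.[ℝ] Lp ℝ 2 m) (Linv : Orlicz N m →ₗ[ℝ] Orlicz N m)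
    (Ψ Φ : ℝ → ℝ → Ω → ℝ) (h : ℝ → Ω → ℝ) (Φ₀ : ℝ → ℝ → Ω → ℝ) : Prop where
  h_bdd : AdaptedBounded ℱ P T h
  phi_eq : ∀ t ∈ Icc (0 : ℝ) T, ∀ (s : ℝ) (ω : Ω), Φ t s ω = h t ω * s + Φ₀ t s ω
  exponents : ∃ (k : ℕ) (r : Fin k → ℝ≥0) (ε δ : Fin k → ℝ)
    (Q : ∀ i, Lp ℝ ((r i : ℝ≥0∞) + 1) m →L[ℝ] Lp ℝ ((r i : ℝ≥0∞) + 1) m),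
    Function.Injective r ∧ (∀ i, 0 < r i) ∧ (∀ i, 0 < ε i) ∧ (∀ i, 0 < δ i) ∧
    (∀ s : ℝ, N s = ∑ i, ε i * |s| ^ ((r i : ℝ) + 1)) ∧
    IsInverse L N r Q Linv ∧
    (∃ (f : ℝ → Ω → ℝ) (c : ℝ), AdaptedL1 ℱ P T f ∧
      (∀ t ∈ Icc (0 : ℝ) T, ∀ ω, 0 ≤ f t ω) ∧ 0 ≤ c ∧
      ∀ t ∈ Icc (0 : ℝ) T, ∀ ω : Ω,
        (∀ s₁ s₂ : ℝ, ∑ i, δ i * |s₂ - s₁| ^ ((r i : ℝ) + 1) ≤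
          (s₂ - s₁) * (Ψ t s₂ ω - Ψ t s₁ ω)) ∧
        (∀ s : ℝ, N s - f t ω * finInd m ≤ s * Ψ t s ω) ∧
        (∀ s : ℝ, s * Ψ t s ω ≤ c * (N s + f t ω * finInd m))) ∧
    (∀ t ∈ Icc (0 : ℝ) T, ∀ (s₁ s₂ : ℝ) (ω : Ω),
      |Φ₀ t s₂ ω - Φ₀ t s₁ ω| ≤ ∑ i, δ i * ‖Q i‖⁻¹ * |s₂ - s₁| ^ (r i : ℝ)) ∧
    (∃ ε₀ : ℝ, 0 < ε₀ ∧ ε₀ < 1 ∧ ∀ t ∈ Icc (0 : ℝ) T, ∀ (s : ℝ) (ω : Ω),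
      |Φ₀ t s ω| ≤ ∑ i, (ε₀ * ‖Q i‖⁻¹ * ε i) * |s| ^ (r i : ℝ))

/-- `A(t,v,ω) = LΨ(t,v,ω) + h_t v - m(Φ₀(t,v,ω) L^{-1}·)` in `V^*`, for `t ∈ [0,T]`. In particular
`Ψ(t,v,ω)` is an element of `L_{N*}` (to which the extension `Λ` of `L` applies), and the last
summand is an integral that exists. -/
def IsDrift {N : YoungFunction} {S : Lp ℝ 2 m →ₗ.[ℝ] Lp ℝ 2 m} {J : Fe S →ₗ[ℝ] (E →ₘ[m] ℝ)}
    (T : ℝ≥0) (Λ : Orlicz N.dual m →L[ℝ] StrongDual ℝ (VSpace N S J))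
    (Linv : Orlicz N m →ₗ[ℝ] Orlicz N m) (Ψ : ℝ → ℝ → Ω → ℝ) (h : ℝ → Ω → ℝ)
    (Φ₀ : ℝ → ℝ → Ω → ℝ) (A : ℝ → VSpace N S J → Ω → StrongDual ℝ (VSpace N S J)) : Prop :=
  ∀ t ∈ Icc (0 : ℝ) T, ∀ (v : VSpace N S J) (ω : Ω), ∃ w : Orlicz N.dual m,
    w.1 =ᵐ[m] (fun e => Ψ t ((VSpace.toLN v).1 e) ω) ∧
    ∀ u : VSpace N S J,
      Integrable (fun e => Φ₀ t ((VSpace.toLN v).1 e) ω * (Linv (VSpace.toLN u)).1 e) m ∧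
      A t v ω u = Λ w u + hToVDual N S J (h t ω • VSpace.toH v) u -
        ∫ e, Φ₀ t ((VSpace.toLN v).1 e) ω * (Linv (VSpace.toLN u)).1 e ∂m

end Coefficients

end PorousMedia

end

noncomputable section

namespace PorousMedia

/-! Under `Δ₂` the modular `m(N(f))` is a finite convex function on `L_N`, bounded by 1 on the unit
ball and hence continuous, and it tends to zero exactly when the norm does
(`DeltaTwo.tendsto_norm_iff`). By Tonelli, `𝔼∫R(z_t)dt` is the modular of `z` over `[0,T] × Ω × E`
plus its squared `L²` norm (`meanR_eq`). So (K) compares modular and norm: the norm is at most one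
plus the modular, and the modular grows at most exponentially in the norm.

For the drift, the Riesz isomorphism turns `-𝓔(x,·)`, seen in `V^*`, into `-m(x ·)`. The extension
`L̄` is therefore the Hölder pairing with a minus sign, and (N1) makes it unique. Hence `A(t,v)u =
-m(Ψ(v)u) + h⟨v,u⟩_H - m(Φ₀(v)L⁻¹u)` (`IsDrift.apply`), and (H1)-(H4) follow from scalar
inequalities that are integrated over `E`.

Two facts carry these. First, monotonicity and `sΨ(s) ≤ c(N(s)+F)` together give `N*(Ψ(s)/c) ≤
N(s)+F` (`MonotoneGrowth.dual_le`), so that `Ψ(v)` lies in `L_{N*}` and all integrals exist. Second,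
under (A2) the factor `κᵢ` cancels the norm of `L⁻¹` in Young's inequality, whose weights `r/(r+1)`
and `1/(r+1)` add up to one (`IsInverse.perturbationBounds`). The increments of `Φ₀` are thus
absorbed by the strong monotonicity of `Ψ`, and `Φ₀` itself costs only a fraction `ε < 1` of the
coercivity. `DriftBounds` collects what (A1) and (A2) have in common. -/

theorem finInd_nonneg {α : Type*} [MeasurableSpace α] (μ : Measure α) : 0 ≤ finInd μ := by
  unfold finInd; split_ifs <;> norm_num

/-- On an infinite measure space the constant is zero. This lets the additive error terms be
integrated without distinguishing finite from infinite mass. -/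
theorem integrable_finInd {α : Type*} [MeasurableSpace α] (μ : Measure α) (c : ℝ) :
    Integrable (fun _ : α => c * finInd μ) μ := by
  unfold finInd
  split_ifs with h
  · have : IsFiniteMeasure μ := ⟨h⟩
    exact integrable_const _
  · simp

/-! ### Modular and Luxemburg norm under `Δ₂` -/

section DeltaTwo

variable {α : Type*} [MeasurableSpace α] {μ : Measure α} {N : YoungFunction}

theorem DeltaTwo.exists_pow (hN : DeltaTwo N μ) :
    ∃ D : ℝ, 1 ≤ D ∧ ∀ (n : ℕ) (s : ℝ), N (2 ^ n * s) ≤ D ^ n * (N s + finInd μ) := by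
  obtain ⟨c, hc, h⟩ := hN
  -- Each doubling multiplies by `c` and adds `c * finInd μ`. With base `2 * c + 1` both
  -- contributions fit into one further factor.
  refine ⟨2 * c + 1, by linarith, fun n s => ?_⟩
  have hi := finInd_nonneg μ
  have hs := N.nonneg' s
  induction n with
  | zero => simpa using hi
  | succ n ih =>
    have h1 : N (2 ^ (n + 1) * s) ≤ c * (N (2 ^ n * s) + finInd μ) := by
      rw [pow_succ', mul_assoc]; exact h _
    have h2 : (1 : ℝ) ≤ (2 * c + 1) ^ n := one_le_pow₀ (by linarith)
    have h3 : finInd μ ≤ (2 * c + 1) ^ n * (N s + finInd μ) := by nlinarith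
    have h4 : 0 ≤ (2 * c + 1) ^ n * (N s + finInd μ) := by positivity
    have h5 : c * N (2 ^ n * s) ≤ c * ((2 * c + 1) ^ n * (N s + finInd μ)) := by gcongr
    have h6 : c * finInd μ ≤ c * ((2 * c + 1) ^ n * (N s + finInd μ)) := by gcongr
    have h7 : (2 * c + 1) ^ (n + 1) * (N s + finInd μ) =
        2 * (c * ((2 * c + 1) ^ n * (N s + finInd μ))) + (2 * c + 1) ^ n * (N s + finInd μ) := by
      ring
    linarith

theorem DeltaTwo.exists_scale (hN : DeltaTwo N μ) (a : ℝ) :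
    ∃ C : ℝ, 0 < C ∧ ∀ s : ℝ, N (a * s) ≤ C * (N s + finInd μ) := by
  obtain ⟨D, hD, h⟩ := hN.exists_pow
  obtain ⟨n, hn⟩ := pow_unbounded_of_one_lt |a| (one_lt_two (α := ℝ))
  refine ⟨D ^ n, by positivity, fun s => (N.mono ?_).trans (h n s)⟩
  rw [abs_mul, abs_mul, abs_of_pos (by positivity : (0 : ℝ) < 2 ^ n)]
  gcongr

/-- For small modulars the constant in the `Δ₂` condition can be made arbitrarily small. -/
theorem DeltaTwo.exists_scale_eps (hN : DeltaTwo N μ) (a : ℝ) {ε : ℝ} (hε : 0 < ε) :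
    ∃ C : ℝ, 0 < C ∧ ∀ s : ℝ, N (a * s) ≤ C * N s + ε * finInd μ := by
  obtain ⟨D, hD, h⟩ := hN.exists_scale a
  have hcont : Tendsto (fun s => N (a * s)) (𝓝 0) (𝓝 0) := by
    have : Continuous fun s => N (a * s) := N.continuous'.comp (by fun_prop)
    simpa [N.map_zero] using this.tendsto 0
  obtain ⟨δ, hδ, hd⟩ := Metric.eventually_nhds_iff.1 (hcont.eventually (gt_mem_nhds hε))
  have hpos : 0 < N (δ / 2) := N.pos (by positivity)
  have hi := finInd_nonneg μ
  -- For `|s| < δ / 2` the value `N (a * s)` is below `ε` by continuity at zero. For larger `s` the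
  -- additive term is at most a multiple of `N s`, because `N s ≥ N (δ / 2)`.
  refine ⟨D * (1 + finInd μ / N (δ / 2)), by positivity, fun s => ?_⟩
  have hs := N.nonneg' s
  rcases lt_or_ge |s| (δ / 2) with hlt | hge
  · have h1 : N (a * s) < ε := hd (by rw [Real.dist_eq, sub_zero]; linarith)
    have h2 := h s
    -- With infinite mass there is no `ε` to spend, but then the scaling bound has no additive term
    -- either.
    unfold finInd at *
    split_ifs at * with hfin
    · have : 0 ≤ D * (1 + 1 / N (δ / 2)) * N s := by positivity
      linarith
    · simpa using h2
  · have h1 : N (δ / 2) ≤ N s := N.mono (by rwa [abs_of_pos (by positivity : 0 < δ / 2)])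
    have h2 : finInd μ ≤ finInd μ / N (δ / 2) * N s := by
      rw [div_mul_eq_mul_div, le_div_iff₀ hpos]; gcongr
    have h3 := h s
    have : 0 ≤ ε * finInd μ := by positivity
    nlinarith

/-- Membership in `L_N` provides one scale `b`; `Δ₂` with the ratio `a / b` transfers integrability
to every scale `a`. -/
theorem DeltaTwo.integrable (hN : DeltaTwo N μ) (f : Orlicz N μ) (a : ℝ) :
    Integrable (fun x => N (a * f.1 x)) μ := by
  obtain ⟨b, hb, hf⟩ := f.2
  obtain ⟨C, hC, h⟩ := hN.exists_scale (a / b)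
  have hm : ∀ c : ℝ, AEStronglyMeasurable (fun x => N (c * f.1 x)) μ := fun c =>
    (N.continuous'.measurable.comp_aemeasurable
      (f.1.aestronglyMeasurable.aemeasurable.const_mul c)).aestronglyMeasurable
  have hi : Integrable (fun x => N (b * f.1 x)) μ := by
    refine ⟨hm b, ?_⟩
    rw [hasFiniteIntegral_iff_ofReal (Eventually.of_forall fun x => N.nonneg' _)]
    exact hf
  have h1 := (hi.const_mul C).add (integrable_finInd μ C)
  refine h1.mono' (hm a) (Eventually.of_forall fun x => ?_)
  rw [Real.norm_of_nonneg (N.nonneg' _)]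
  have h2 := h (b * f.1 x)
  rw [← mul_assoc, div_mul_cancel₀ _ hb.ne'] at h2
  simpa [mul_add] using h2

theorem DeltaTwo.integrable_one (hN : DeltaTwo N μ) (f : Orlicz N μ) :
    Integrable (fun x => N (f.1 x)) μ := by
  simpa using hN.integrable f 1

theorem mem_orlicz_of_integrable {f : α →ₘ[μ] ℝ} {a : ℝ} (ha : 0 < a)
    (h : Integrable (fun x => N (a * f x)) μ) : f ∈ Orlicz N μ :=
  ⟨a, ha, (hasFiniteIntegral_iff_ofReal (Eventually.of_forall fun _ => N.nonneg' _)).1 h.2⟩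

/-- The modular `μ(N(f))` as a real number. -/
def orliczMod (f : Orlicz N μ) : ℝ := ∫ x, N (f.1 x) ∂μ

theorem orliczMod_nonneg (f : Orlicz N μ) : 0 ≤ orliczMod f :=
  integral_nonneg fun x => N.nonneg' (f.1 x)

theorem DeltaTwo.modular_eq (hN : DeltaTwo N μ) (f : Orlicz N μ) :
    modular N μ f.1 = ENNReal.ofReal (orliczMod f) :=
  (ofReal_integral_eq_lintegral_ofReal (hN.integrable_one f)
    (Eventually.of_forall fun _ => N.nonneg' _)).symm

theorem orliczMod_smul (a : ℝ) (f : Orlicz N μ) :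
    orliczMod (a • f) = ∫ x, N (a * f.1 x) ∂μ := by
  refine integral_congr_ae ?_
  filter_upwards [AEEqFun.coeFn_smul a f.1] with x hx
  rw [Submodule.coe_smul, hx, Pi.smul_apply, smul_eq_mul]

theorem orliczMod_neg (f : Orlicz N μ) : orliczMod (-f) = orliczMod f := by
  rw [← neg_one_smul ℝ, orliczMod_smul]
  simp only [neg_one_mul, N.even', orliczMod]

theorem orliczMod_zero : orliczMod (0 : Orlicz N μ) = 0 := by
  rw [← zero_smul ℝ (0 : Orlicz N μ), orliczMod_smul]
  simp [N.map_zero]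

theorem DeltaTwo.orliczMod_convex (hN : DeltaTwo N μ) :
    ConvexOn ℝ univ (orliczMod : Orlicz N μ → ℝ) := by
  refine ⟨convex_univ, fun f _ g _ a b ha hb hab => ?_⟩
  unfold orliczMod
  rw [smul_eq_mul, smul_eq_mul, ← integral_const_mul, ← integral_const_mul,
    ← integral_add ((hN.integrable_one f).const_mul a) ((hN.integrable_one g).const_mul b)]
  refine integral_mono_ae (hN.integrable_one _)
    (((hN.integrable_one f).const_mul a).add ((hN.integrable_one g).const_mul b)) ?_
  filter_upwards [AEEqFun.coeFn_add (a • f.1) (b • g.1), AEEqFun.coeFn_smul a f.1,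
    AEEqFun.coeFn_smul b g.1] with x h1 h2 h3
  simp only [Submodule.coe_add, Submodule.coe_smul, h1, h2, h3, Pi.add_apply, Pi.smul_apply]
  exact N.convex'.2 (mem_univ _) (mem_univ _) ha hb hab

/-- Write `f = l * (f / l)`. Convexity and `N 0 = 0` pull the factor `l ≤ 1` out of `N`, and the
modular of `f / l` is at most one. -/
theorem DeltaTwo.orliczMod_le (hN : DeltaTwo N μ) {f : Orlicz N μ} {l : ℝ} (hl : ‖f‖ < l)
    (hl1 : l ≤ 1) : orliczMod f ≤ l := by
  have h := luxSet_of_lt N f hl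
  have h1 := modular_scale N (μ := μ) (f := fun x => f.1 x / l) h.1.le hl1
  have h2 : (fun x => l * (f.1 x / l)) = f.1 := by
    funext x; rw [mul_div_cancel₀ _ h.1.ne']
  rw [h2, hN.modular_eq] at h1
  have h3 : ENNReal.ofReal (orliczMod f) ≤ ENNReal.ofReal l * 1 := h1.trans (by gcongr; exact h.2)
  rw [mul_one] at h3
  exact (ENNReal.ofReal_le_ofReal_iff h.1.le).1 h3

theorem DeltaTwo.orliczMod_le_norm (hN : DeltaTwo N μ) {f : Orlicz N μ} (hf : ‖f‖ < 1) :
    orliczMod f ≤ ‖f‖ := by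
  refine le_of_forall_gt_imp_ge_of_dense fun l hl => ?_
  rcases le_total l 1 with h | h
  · exact hN.orliczMod_le hl h
  · exact (hN.orliczMod_le hf le_rfl).trans h

theorem DeltaTwo.norm_le_of_orliczMod_le (hN : DeltaTwo N μ) {f : Orlicz N μ} {l : ℝ}
    (hl : 0 < l) (h : orliczMod (l⁻¹ • f) ≤ 1) : ‖f‖ ≤ l := by
  refine csInf_le (luxSet_bddBelow N μ _) ⟨hl, ?_⟩
  have h1 : modular N μ (fun x => f.1 x / l) = modular N μ (l⁻¹ • f).1 := by
    refine modular_congr N ?_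
    filter_upwards [AEEqFun.coeFn_smul l⁻¹ f.1] with x hx
    rw [Submodule.coe_smul, hx, Pi.smul_apply, smul_eq_mul, div_eq_inv_mul]
  rw [h1, hN.modular_eq]
  exact ENNReal.ofReal_le_one.2 h

theorem DeltaTwo.orliczMod_smul_le (hN : DeltaTwo N μ) (f : Orlicz N μ) {a : ℝ} (ha : 0 ≤ a)
    (ha1 : a ≤ 1) : orliczMod (a • f) ≤ a * orliczMod f := by
  simpa [orliczMod_zero] using hN.orliczMod_convex.2 (mem_univ f) (mem_univ 0) ha
    (sub_nonneg.2 ha1) (by ring)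

/-- Dividing `f` by one plus its modular divides the modular by at least as much, which brings it
below one. -/
theorem DeltaTwo.norm_le (hN : DeltaTwo N μ) (f : Orlicz N μ) : ‖f‖ ≤ 1 + orliczMod f := by
  have h0 := orliczMod_nonneg f
  refine hN.norm_le_of_orliczMod_le (by positivity) ?_
  refine (hN.orliczMod_smul_le f (by positivity) (inv_le_one_of_one_le₀ (by linarith))).trans ?_
  rw [inv_mul_le_iff₀ (by positivity)]
  linarith

/-- A finite convex function on a normed space is continuous as soon as it is bounded above near one
point; here the unit ball around zero serves. -/
theorem DeltaTwo.continuous_orliczMod (hN : DeltaTwo N μ) :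
    Continuous (orliczMod : Orlicz N μ → ℝ) := by
  rw [← continuousOn_univ]
  apply ((hN.orliczMod_convex.continuousOn_tfae isOpen_univ univ_nonempty).out 1 3).2
  refine ⟨0, mem_univ _, 1, ?_⟩
  rw [eventually_map]
  filter_upwards [Metric.ball_mem_nhds (0 : Orlicz N μ) one_pos] with f hf
  rw [mem_ball_zero_iff] at hf
  exact (hN.orliczMod_le_norm hf).trans hf.le

theorem DeltaTwo.tendsto_norm_iff (hN : DeltaTwo N μ) {β : Type*} {l : Filter β}
    (f : β → Orlicz N μ) :
    Tendsto (fun n => ‖f n‖) l (𝓝 0) ↔ Tendsto (fun n => orliczMod (f n)) l (𝓝 0) := by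
  constructor
  · intro h
    have := (hN.continuous_orliczMod.tendsto 0).comp (tendsto_zero_iff_norm_tendsto_zero.2 h)
    rwa [orliczMod_zero] at this
  · intro h
    refine (tendsto_order.2 ⟨fun a ha => Eventually.of_forall fun n => ha.trans_le (norm_nonneg _),
      fun a ha => ?_⟩)
    set M := finInd μ * μ.real univ with hM
    have hM0 : 0 ≤ M := mul_nonneg (finInd_nonneg μ) measureReal_nonneg
    -- The modular of `f n / (a / 2)` has to drop below one. `M` is the total mass if that is finite
    -- and zero otherwise, so this `ε` makes the error integrate to at most `1 / 2`; the other half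
    -- comes from the small modular of `f n`.
    obtain ⟨C, hC, hb⟩ := hN.exists_scale_eps (a / 2)⁻¹ (ε := 1 / (2 * (M + 1))) (by positivity)
    have h1 : ∀ᶠ n in l, orliczMod (f n) < 1 / (2 * C) := h.eventually (gt_mem_nhds (by positivity))
    filter_upwards [h1] with n hn
    refine (hN.norm_le_of_orliczMod_le (half_pos ha) ?_).trans_lt (half_lt_self ha)
    rw [orliczMod_smul]
    have hint := (((hN.integrable_one (f n)).const_mul C).add
      (integrable_finInd μ (1 / (2 * (M + 1)))))
    refine (integral_mono (hN.integrable (f n) _) hint fun x => hb _).trans ?_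
    simp only [Pi.add_apply]
    rw [integral_add ((hN.integrable_one (f n)).const_mul C) (integrable_finInd μ _),
      integral_const_mul, integral_const, smul_eq_mul]
    have h2 : C * ∫ x, N ((f n).1 x) ∂μ ≤ 1 / 2 := by
      have := mul_le_mul_of_nonneg_left hn.le hC.le
      refine this.trans (le_of_eq ?_)
      field_simp
    have h3 : μ.real univ * (1 / (2 * (M + 1)) * finInd μ) = M / (2 * (M + 1)) := by
      rw [hM]; ring
    have h4 : M / (2 * (M + 1)) ≤ 1 / 2 := by
      rw [div_le_div_iff₀ (by positivity) (by positivity)]; linarith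
    rw [h3]; linarith

/-- Under `Δ₂` the modular grows at most exponentially in the norm. -/
theorem DeltaTwo.exists_orliczMod_le_pow (hN : DeltaTwo N μ) :
    ∃ D M : ℝ, 1 ≤ D ∧ 0 ≤ M ∧ ∀ (f : Orlicz N μ) (n : ℕ), ‖f‖ ≤ n →
      orliczMod f ≤ D ^ n * (1 + M) := by
  obtain ⟨D, hD, h⟩ := hN.exists_pow
  refine ⟨D, finInd μ * μ.real univ, hD, mul_nonneg (finInd_nonneg μ) measureReal_nonneg,
    fun f n hn => ?_⟩
  -- Since `n < 2 ^ n`, scaling by `2 ^ n` brings `f` into the unit ball; undoing it costs `n`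
  -- doublings.
  set g : Orlicz N μ := ((2 : ℝ) ^ n)⁻¹ • f with hg
  have hfg : f = (2 : ℝ) ^ n • g := by rw [hg, smul_smul, mul_inv_cancel₀ (by positivity), one_smul]
  have hg1 : ‖g‖ < 1 := by
    rw [hg, norm_smul, norm_inv, Real.norm_of_nonneg (by positivity), inv_mul_lt_iff₀ (by positivity),
      mul_one]
    exact hn.trans_lt (by exact_mod_cast Nat.lt_two_pow_self)
  have hg2 := (hN.orliczMod_le_norm hg1).trans hg1.le
  rw [hfg, orliczMod_smul]
  have hint := ((hN.integrable_one g).add (by simpa using integrable_finInd μ 1)).const_mul (D ^ n)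
  refine (integral_mono (hN.integrable g _) hint fun x => h n _).trans ?_
  simp only [Pi.add_apply]
  rw [integral_const_mul, integral_add (hN.integrable_one g) (by simpa using integrable_finInd μ 1),
    integral_const, smul_eq_mul, mul_comm (μ.real univ)]
  gcongr
  exact hg2

/-- The set for `g` must be nonempty, since the infimum of the empty set is zero by convention. -/
theorem luxNorm_mono {f g : α → ℝ} (hg : (luxSet N μ g).Nonempty) (h : ∀ᵐ x ∂μ, |f x| ≤ |g x|) :
    luxNorm N μ f ≤ luxNorm N μ g := by
  refine csInf_le_csInf (luxSet_bddBelow N μ f) hg fun l hl => ⟨hl.1, le_trans ?_ hl.2⟩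
  refine lintegral_mono_ae (h.mono fun x hx => ENNReal.ofReal_le_ofReal (N.mono ?_))
  rw [abs_div, abs_div]
  gcongr

theorem norm_orlicz_mono {f g : Orlicz N μ} (h : ∀ᵐ x ∂μ, |f.1 x| ≤ |g.1 x|) : ‖f‖ ≤ ‖g‖ :=
  luxNorm_mono (luxSet_nonempty N g) h

end DeltaTwo

/-! ### The function `R` on `V` -/

section VSpaceBasic

variable {E : Type*} [MeasurableSpace E] {m : Measure E} {N : YoungFunction}
  {S : Lp ℝ 2 m →ₗ.[ℝ] Lp ℝ 2 m} {J : Fe S →ₗ[ℝ] (E →ₘ[m] ℝ)}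

theorem VSpace.toLN_add (u v : VSpace N S J) : toLN (u + v) = toLN u + toLN v := rfl

theorem VSpace.toLN_sub (u v : VSpace N S J) : toLN (u - v) = toLN u - toLN v := rfl

theorem VSpace.toLN_smul (c : ℝ) (v : VSpace N S J) : toLN (c • v) = c • toLN v := rfl

theorem VSpace.toLN_neg (v : VSpace N S J) : toLN (-v) = -toLN v := rfl

theorem VSpace.toLN_zero : toLN (0 : VSpace N S J) = 0 := rfl

theorem VSpace.norm_toLN_le (v : VSpace N S J) : ‖toLN v‖ ≤ ‖v‖ := by
  rw [norm_eq_add]; linarith [norm_nonneg (toH v)]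

theorem VSpace.continuous_toLN : Continuous (toLN : VSpace N S J → Orlicz N m) :=
  (LinearMap.mkContinuous
    ({ toFun := toLN, map_add' := toLN_add, map_smul' := toLN_smul } :
      VSpace N S J →ₗ[ℝ] Orlicz N m) 1 fun v => by
        rw [one_mul]; exact norm_toLN_le v).continuous

theorem RFun_eq (v : VSpace N S J) :
    RFun N S J v = orliczMod (VSpace.toLN v) + ‖VSpace.toH v‖ ^ 2 := rfl

theorem RFun_nonneg (v : VSpace N S J) : 0 ≤ RFun N S J v :=
  add_nonneg (orliczMod_nonneg _) (sq_nonneg _)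

theorem continuous_RFun (hN : DeltaTwo N m) : Continuous (RFun N S J) :=
  (hN.continuous_orliczMod.comp VSpace.continuous_toLN).add (VSpace.toH.continuous.norm.pow 2)

theorem RFun_neg (v : VSpace N S J) : RFun N S J (-v) = RFun N S J v := by
  rw [RFun_eq, RFun_eq, map_neg, norm_neg, VSpace.toLN_neg, orliczMod_neg]

theorem RFun_zero : RFun N S J 0 = 0 := by
  rw [RFun_eq, VSpace.toLN_zero, orliczMod_zero, map_zero, norm_zero]; norm_num

/-- `x + y` is the midpoint of `2x` and `2y`, so convexity bounds the modular part; the squared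
norms follow from `(a + b)² ≤ 2a² + 2b²`. -/
theorem RFun_add_le (hN : DeltaTwo N m) (x y : VSpace N S J) :
    RFun N S J (x + y) ≤ RFun N S J ((2 : ℝ) • x) + RFun N S J ((2 : ℝ) • y) := by
  simp only [RFun_eq, VSpace.toLN_add, VSpace.toLN_smul, map_add, map_smul, norm_smul]
  have h1 := hN.orliczMod_convex.2 (mem_univ ((2 : ℝ) • VSpace.toLN x))
    (mem_univ ((2 : ℝ) • VSpace.toLN y)) (by norm_num : (0 : ℝ) ≤ 1 / 2)
    (by norm_num : (0 : ℝ) ≤ 1 / 2) (by norm_num)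
  simp only [smul_smul, one_div, inv_mul_cancel₀ (two_ne_zero' ℝ), one_smul, smul_eq_mul] at h1
  have hx := orliczMod_nonneg ((2 : ℝ) • VSpace.toLN x)
  have hy := orliczMod_nonneg ((2 : ℝ) • VSpace.toLN y)
  have h2 := norm_add_le (VSpace.toH x) (VSpace.toH y)
  have h3 := norm_nonneg (VSpace.toH x + VSpace.toH y)
  have h4 : ‖VSpace.toH x + VSpace.toH y‖ ^ 2 ≤ (‖VSpace.toH x‖ + ‖VSpace.toH y‖) ^ 2 := by gcongr
  rw [Real.norm_of_nonneg (by norm_num : (0 : ℝ) ≤ 2)]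
  nlinarith [sq_nonneg (‖VSpace.toH x‖ - ‖VSpace.toH y‖)]

/-- Serves to identify `KSpace.eval`, which is defined by choice, with an explicitly given family of
slices. -/
theorem IsSlice.unique {Ω : Type*} {f : (ℝ × Ω) × E → ℝ} {φ : ℝ × Ω → GreenSpace S} {p : ℝ × Ω}
    {v w : VSpace N S J} (hv : IsSlice f φ p v) (hw : IsSlice f φ p w) : v = w :=
  Subtype.ext (Prod.ext (Subtype.ext (AEEqFun.ext (hv.1.trans hw.1.symm)))
    (hv.2.trans hw.2.symm))

end VSpaceBasic

/-! ### Condition (K) -/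

section KSpaceNorm

theorem tendsto_add_zero_iff {β : Type*} {l : Filter β} {f g : β → ℝ} (hf : ∀ x, 0 ≤ f x)
    (hg : ∀ x, 0 ≤ g x) :
    Tendsto (fun x => f x + g x) l (𝓝 0) ↔ Tendsto f l (𝓝 0) ∧ Tendsto g l (𝓝 0) := by
  constructor
  · intro h
    exact ⟨squeeze_zero hf (fun x => le_add_of_nonneg_right (hg x)) h,
      squeeze_zero hg (fun x => le_add_of_nonneg_left (hf x)) h⟩
  · rintro ⟨h1, h2⟩
    simpa using h1.add h2

theorem mem_orlicz_of_abs_le {α : Type*} [MeasurableSpace α] {μ : Measure α} {N : YoungFunction}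
    {f : α →ₘ[μ] ℝ} (g : Orlicz N μ) (h : ∀ᵐ x ∂μ, |f x| ≤ |g.1 x|) : f ∈ Orlicz N μ := by
  obtain ⟨a, ha, hg⟩ := g.2
  refine ⟨a, ha, lt_of_le_of_lt (lintegral_mono_ae (h.mono fun x hx => ?_)) hg⟩
  refine ENNReal.ofReal_le_ofReal (N.mono ?_)
  rw [abs_mul, abs_mul]
  gcongr

variable {E : Type*} [MeasurableSpace E] {m : Measure E} {N : YoungFunction}
  {S : Lp ℝ 2 m →ₗ.[ℝ] Lp ℝ 2 m} {J : Fe S →ₗ[ℝ] (E →ₘ[m] ℝ)}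
  {Ω : Type*} [MeasurableSpace Ω] {P : Measure Ω} {T : ℝ≥0}

theorem lintegral_norm_sq_eq {α F : Type*} [MeasurableSpace α] [NormedAddCommGroup F]
    {μ : Measure α} (φ : Lp F 2 μ) :
    ∫⁻ p, ENNReal.ofReal (‖φ p‖ ^ 2) ∂μ = ENNReal.ofReal (‖φ‖ ^ 2) := by
  have h := eLpNorm_nnreal_pow_eq_lintegral (f := φ) (μ := μ) (p := 2) two_ne_zero
  rw [Lp.norm_def, ← ENNReal.toReal_pow, ENNReal.ofReal_toReal
    (ENNReal.pow_ne_top (Lp.memLp φ).2.ne)]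
  simp only [NNReal.coe_ofNat, ENNReal.rpow_ofNat, ENNReal.coe_ofNat] at h
  rw [h]
  refine lintegral_congr fun x => ?_
  rw [ENNReal.ofReal_pow (norm_nonneg _), ofReal_norm]

theorem timeProb_univ [IsProbabilityMeasure P] : timeProb T P univ = T := by
  rw [timeProb, ← univ_prod_univ, Measure.prod_prod]
  simp

/-- `Δ₂` sees the measure only through the finiteness of its mass, and `timeProb` has the mass `T`,
finite and nonzero. With `T = 0` the product could be finite although `m` is not. -/
theorem DeltaTwo.prod_timeProb [IsProbabilityMeasure P] [SigmaFinite m] (hT : 0 < T)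
    (hN : DeltaTwo N m) : DeltaTwo N ((timeProb T P).prod m) := by
  have h : (timeProb T P).prod m univ < ∞ ↔ m univ < ∞ := by
    rw [← univ_prod_univ, Measure.prod_prod, timeProb_univ, lt_top_iff_ne_top, lt_top_iff_ne_top,
      not_iff_not, ENNReal.mul_eq_top]
    simp [hT.ne']
  obtain ⟨c, hc, hb⟩ := hN
  refine ⟨c, hc, fun s => ?_⟩
  simpa only [h] using hb s

variable [SigmaFinite m]

/-- Both components are multiplied by `h`. The slices of the product are `h p` times those of `z`,
which keeps the pair in `K`. -/
theorem exists_smul_eval {h : ℝ × Ω → ℝ} (hh : MemLp h ∞ (timeProb T P))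
    (z : KSpace N S J T P) :
    ∃ y : KSpace N S J T P,
      (∀ᵐ p ∂(timeProb T P), KSpace.eval y p = h p • KSpace.eval z p) ∧
        ‖y‖ ≤ (eLpNorm h ∞ (timeProb T P)).toReal * ‖z‖ := by
  set μ := timeProb T P
  set c := (eLpNorm h ∞ μ).toReal with hc
  have hc0 : 0 ≤ c := ENNReal.toReal_nonneg
  have hle : ∀ᵐ p ∂μ, |h p| ≤ c := by
    filter_upwards [ae_le_eLpNormEssSup (f := h) (μ := μ)] with p hp
    rw [← eLpNorm_exponent_top] at hp
    rw [← Real.norm_eq_abs, ← toReal_enorm]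
    exact ENNReal.toReal_mono hh.2.ne hp
  have hmeas : AEStronglyMeasurable (fun q : (ℝ × Ω) × E => h q.1 * z.1.1.1 q) (μ.prod m) :=
    hh.1.comp_fst.mul z.1.1.1.aestronglyMeasurable
  -- The pointwise domination by `c • z` gives both membership in `L_N` and the bound on the
  -- Luxemburg norm.
  have hfle : ∀ᵐ q ∂(μ.prod m), |AEEqFun.mk _ hmeas q| ≤ |(c • z.1.1 : Orlicz N (μ.prod m)).1 q| := by
    filter_upwards [AEEqFun.coeFn_mk _ hmeas, AEEqFun.coeFn_smul c z.1.1.1,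
      Measure.quasiMeasurePreserving_fst.ae hle] with q h1 h2 h3
    rw [h1, Submodule.coe_smul, h2, Pi.smul_apply, smul_eq_mul, abs_mul, abs_mul, abs_of_nonneg hc0]
    gcongr
  let f : Orlicz N (μ.prod m) := ⟨AEEqFun.mk _ hmeas, mem_orlicz_of_abs_le _ hfle⟩
  have hφ : MemLp (h • (z.1.2 : ℝ × Ω → GreenSpace S)) 2 μ := (Lp.memLp z.1.2).smul hh
  let φ : Lp (GreenSpace S) 2 μ := hφ.toLp _
  have hslice : ∀ᵐ p ∂μ, IsSlice f.1 φ p (h p • KSpace.eval z p) := by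
    filter_upwards [KSpace.isSlice_eval z, hφ.coeFn_toLp,
      Measure.ae_ae_of_ae_prod (AEEqFun.coeFn_mk _ hmeas)] with p hp h1 h2
    refine ⟨?_, ?_⟩
    · filter_upwards [hp.1, h2, AEEqFun.coeFn_smul (h p) (VSpace.toLN (KSpace.eval z p)).1]
        with e h3 h4 h5
      rw [VSpace.toLN_smul, Submodule.coe_smul, h5, Pi.smul_apply, h3, smul_eq_mul]
      exact h4.symm
    · rw [map_smul, hp.2]
      exact h1.symm
  let y : KSpace N S J T P := ⟨(f, φ), hslice.mono fun p hp => ⟨_, hp⟩⟩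
  refine ⟨y, ?_, ?_⟩
  · filter_upwards [KSpace.isSlice_eval y, hslice] with p h1 h2
    exact h1.unique h2
  · rw [KSpace.norm_eq_add, KSpace.norm_eq_add, mul_add]
    refine add_le_add ?_ ?_
    · refine (norm_orlicz_mono hfle).trans ?_
      rw [norm_smul, Real.norm_of_nonneg hc0]
    · refine Lp.norm_le_mul_norm_of_ae_le_mul ?_
      filter_upwards [hφ.coeFn_toLp, hle] with p h1 h2
      change ‖(hφ.toLp _ : Lp (GreenSpace S) 2 μ) p‖ ≤ _
      rw [h1, Pi.smul_apply', norm_smul, Real.norm_eq_abs]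
      gcongr

variable [IsProbabilityMeasure P]

/-- `𝔼 ∫ R(z_t) dt` is the modular of the first plus the squared norm of the second component. -/
theorem meanR_eq (hT : 0 < T) (hN : DeltaTwo N m) (z : KSpace N S J T P) :
    meanR (timeProb T P) (RFun N S J) (KSpace.eval z) =
      ENNReal.ofReal (orliczMod z.1.1 + ‖z.1.2‖ ^ 2) := by
  have hmeas : AEMeasurable (fun q => ENNReal.ofReal (N (z.1.1.1 q))) ((timeProb T P).prod m) :=
    (N.continuous'.measurable.comp_aemeasurable
      z.1.1.1.aestronglyMeasurable.aemeasurable).ennreal_ofReal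
  -- Tonelli splits the modular over the product into the modulars of the slices.
  rw [ENNReal.ofReal_add (orliczMod_nonneg _) (sq_nonneg _), ← (hN.prod_timeProb hT).modular_eq,
    ← lintegral_norm_sq_eq, modular, lintegral_prod _ hmeas, ← lintegral_add_left' hmeas.lintegral_prod_right', meanR]
  refine lintegral_congr_ae ?_
  filter_upwards [KSpace.isSlice_eval z] with p hp
  rw [RFun_eq, ENNReal.ofReal_add (orliczMod_nonneg _) (sq_nonneg _), ← hN.modular_eq, hp.2,
    modular_congr N hp.1]
  rfl

/-- The exponential growth of the modular in the norm, put in logarithmic form. Solved for `‖z‖`, it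
supplies the lower bound `W₁` in (K). -/
theorem exists_log_bound (hT : 0 < T) (hN : DeltaTwo N m) :
    ∃ a b : ℝ, 0 < a ∧ ∀ z : KSpace N S J T P,
      Real.log (1 + (orliczMod z.1.1 + ‖z.1.2‖ ^ 2)) ≤ a * ‖z‖ + b := by
  obtain ⟨D, M, hD, hM, h⟩ := (hN.prod_timeProb (P := P) hT).exists_orliczMod_le_pow
  have hD4 : (4 : ℝ) ≤ max D 4 := le_max_right _ _
  have hlog : 0 < Real.log (max D 4) := Real.log_pos (by linarith)
  -- The base is at least 4 because `‖z.1.2‖ ^ 2 ≤ (2 ^ n) ^ 2`. In `3 + M`, the part `1 + M`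
  -- belongs to the modular, one unit to this square and one to the summand `1` inside the
  -- logarithm.
  refine ⟨Real.log (max D 4), Real.log (max D 4) + Real.log (3 + M), hlog, fun z => ?_⟩
  set n := ⌈‖z‖⌉₊
  have hn : ‖z‖ ≤ n := Nat.le_ceil _
  have hn1 : (n : ℝ) ≤ ‖z‖ + 1 := (Nat.ceil_lt_add_one (norm_nonneg z)).le
  have hz := KSpace.norm_eq_add z
  have h1 := h z.1.1 n (by linarith [norm_nonneg z.1.2])
  have h2 : ‖z.1.2‖ ^ 2 ≤ 4 ^ n := by
    have h3 : ‖z.1.2‖ ≤ 2 ^ n := by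
      have : (n : ℝ) ≤ 2 ^ n := by exact_mod_cast Nat.lt_two_pow_self.le
      linarith [norm_nonneg z.1.1]
    calc ‖z.1.2‖ ^ 2 ≤ (2 ^ n) ^ 2 := by gcongr
      _ = 4 ^ n := by rw [← pow_mul, mul_comm, pow_mul]; norm_num
  have h4 : (4 : ℝ) ^ n ≤ max D 4 ^ n := by gcongr
  have h5 : D ^ n * (1 + M) ≤ max D 4 ^ n * (1 + M) := by gcongr; exact le_max_left _ _
  have h6 : 1 ≤ max D 4 ^ n := one_le_pow₀ (by linarith)
  have h7 : 1 + (orliczMod z.1.1 + ‖z.1.2‖ ^ 2) ≤ max D 4 ^ n * (3 + M) := by linarith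
  have h8 : 0 < 1 + (orliczMod z.1.1 + ‖z.1.2‖ ^ 2) := by
    linarith [orliczMod_nonneg z.1.1, sq_nonneg ‖z.1.2‖]
  refine (Real.log_le_log h8 h7).trans ?_
  rw [Real.log_mul (by positivity) (by positivity), Real.log_pow]
  nlinarith

theorem condK (hT : 0 < T) (hN : DeltaTwo N m) :
    CondK (timeProb T P) (KSpace.eval : KSpace N S J T P → _) (RFun N S J) where
  continuous := continuous_RFun hN
  nonneg := RFun_nonneg
  symm v := (RFun_neg v).symm
  zero := RFun_zero
  tendsto_iff z := by
    simp only [meanR_eq hT hN, KSpace.norm_eq_add]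
    have hpos : ∀ n, 0 ≤ orliczMod (z n).1.1 + ‖(z n).1.2‖ ^ 2 := fun n =>
      add_nonneg (orliczMod_nonneg _) (sq_nonneg _)
    have h1 : Tendsto (fun n => ENNReal.ofReal (orliczMod (z n).1.1 + ‖(z n).1.2‖ ^ 2)) atTop (𝓝 0) ↔
        Tendsto (fun n => orliczMod (z n).1.1 + ‖(z n).1.2‖ ^ 2) atTop (𝓝 0) := by
      constructor
      · intro h
        have h2 := (ENNReal.tendsto_toReal ENNReal.zero_ne_top).comp h
        refine (h2.congr fun n => ?_)
        exact ENNReal.toReal_ofReal (hpos n)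
      · intro h
        simpa using ENNReal.tendsto_ofReal h
    rw [h1, tendsto_add_zero_iff (fun n => norm_nonneg _) (fun n => norm_nonneg _),
      tendsto_add_zero_iff (fun n => orliczMod_nonneg _) (fun n => sq_nonneg _),
      (hN.prod_timeProb hT).tendsto_norm_iff]
    refine and_congr_right fun _ => ⟨fun h => by simpa using h.pow 2, fun h => ?_⟩
    have := (Real.continuous_sqrt.tendsto 0).comp h
    rw [Real.sqrt_zero] at this
    exact this.congr fun n => Real.sqrt_sq (norm_nonneg _)
  bounds := by
    obtain ⟨a, b, ha, hb⟩ := exists_log_bound (N := N) (S := S) (J := J) (P := P) hT hN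
    -- `W₁` inverts the logarithmic bound. `W₂ r = 2 + r` comes from norm ≤ 1 + modular for the
    -- first component and `x ≤ 1 + x²` for the second.
    refine ⟨fun r => (Real.log (1 + r) - b) / a, fun r => 2 + r, ⟨fun r => ?_, ?_⟩,
      ⟨fun r => ⟨2 + r, fun s hs => ?_⟩, tendsto_atTop_add_const_left _ _ tendsto_id⟩, fun z => ?_⟩
    · refine ⟨(Real.log (1 + r) + |b|) / a, fun s hs => ?_⟩
      rw [abs_div, abs_of_pos ha]
      have h0 : 0 ≤ Real.log (1 + s) := Real.log_nonneg (by linarith [hs.1])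
      have h1 : Real.log (1 + s) ≤ Real.log (1 + r) :=
        Real.log_le_log (by linarith [hs.1]) (by linarith [hs.2])
      have h2 := abs_sub (Real.log (1 + s)) b
      rw [abs_of_nonneg h0] at h2
      gcongr
      linarith
    · refine Tendsto.atTop_div_const ha (tendsto_atTop_add_const_right _ _ ?_)
      exact Real.tendsto_log_atTop.comp (tendsto_atTop_add_const_left _ _ tendsto_id)
    · rw [abs_of_nonneg (by linarith [hs.1])]; linarith [hs.2]
    · rw [meanR_eq hT hN]
      have h0 := orliczMod_nonneg z.1.1
      rw [ENNReal.toReal_ofReal (add_nonneg h0 (sq_nonneg _))]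
      refine ⟨ENNReal.ofReal_lt_top, ?_, ?_⟩
      · rw [div_le_iff₀ ha]
        linarith [hb z]
      · rw [KSpace.norm_eq_add]
        have h1 := (hN.prod_timeProb (P := P) hT).norm_le z.1.1
        nlinarith [sq_nonneg (‖z.1.2‖ - 1)]
  add_le := ⟨1, one_pos, fun x y => by rw [one_mul]; exact RFun_add_le hN x y⟩
  mul_mem _ hh z := exists_smul_eval hh z

end KSpaceNorm

/-! ### Hölder pairing and the extension of `L̄` -/

section Duality

variable {E : Type*} [MeasurableSpace E] {m : Measure E} {N : YoungFunction}
  {S : Lp ℝ 2 m →ₗ.[ℝ] Lp ℝ 2 m} {J : Fe S →ₗ[ℝ] (E →ₘ[m] ℝ)}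

theorem YoungFunction.abs_mul_le (N : YoungFunction) (s t : ℝ) : |s * t| ≤ N s + N.dual t := by
  have h := N.le_dualFun (abs_nonneg s) t
  rw [N.abs_eq] at h
  rw [abs_mul]
  change _ ≤ N s + N.dualFun t
  linarith

theorem YoungFunction.add_le (N : YoungFunction) (s t : ℝ) : N (s + t) ≤ N (2 * s) + N (2 * t) := by
  have h := N.convex'.2 (mem_univ (2 * s)) (mem_univ (2 * t)) (by norm_num : (0 : ℝ) ≤ 1 / 2)
    (by norm_num : (0 : ℝ) ≤ 1 / 2) (by norm_num)
  simp only [smul_eq_mul] at h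
  have h1 : 1 / 2 * (2 * s) + 1 / 2 * (2 * t) = s + t := by ring
  rw [h1] at h
  linarith [N.nonneg' (2 * s), N.nonneg' (2 * t)]

/-- The pairing `m(f g)` of `f ∈ L_{N*}` and `g ∈ L_N`. -/
def orliczPairing (N : YoungFunction) (m : Measure E) :
    Orlicz N.dual m →ₗ[ℝ] Orlicz N m →ₗ[ℝ] ℝ :=
  LinearMap.mk₂ ℝ (fun w f => ∫ e, f.1 e * w.1 e ∂m)
    (fun w w' f => by
      rw [← integral_add (integrable_mul_of_orlicz N f.2 w.2) (integrable_mul_of_orlicz N f.2 w'.2)]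
      refine integral_congr_ae ?_
      filter_upwards [AEEqFun.coeFn_add w.1 w'.1] with e he
      rw [Submodule.coe_add, he, Pi.add_apply, mul_add])
    (fun c w f => by
      rw [smul_eq_mul, ← integral_const_mul]
      refine integral_congr_ae ?_
      filter_upwards [AEEqFun.coeFn_smul c w.1] with e he
      rw [Submodule.coe_smul, he, Pi.smul_apply, smul_eq_mul]; ring)
    (fun w f f' => by
      rw [← integral_add (integrable_mul_of_orlicz N f.2 w.2) (integrable_mul_of_orlicz N f'.2 w.2)]
      refine integral_congr_ae ?_
      filter_upwards [AEEqFun.coeFn_add f.1 f'.1] with e he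
      rw [Submodule.coe_add, he, Pi.add_apply, add_mul])
    (fun c w f => by
      rw [smul_eq_mul, ← integral_const_mul]
      refine integral_congr_ae ?_
      filter_upwards [AEEqFun.coeFn_smul c f.1] with e he
      rw [Submodule.coe_smul, he, Pi.smul_apply, smul_eq_mul]; ring)

/-- Hölder's inequality for Orlicz spaces. -/
theorem abs_orliczPairing_le (hN : DeltaTwo N m) (hN' : DeltaTwo N.dual m) (w : Orlicz N.dual m)
    (f : Orlicz N m) : |orliczPairing N m w f| ≤ 8 * ‖w‖ * ‖f‖ := by
  -- On balls of radius `1 / 2` both modulars are at most `1 / 2`, and Young's inequality bounds the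
  -- pairing, generously, by 2. Homogeneity in each variable costs a factor 2, whence the constant
  -- 8.
  have h1 : ∀ w ∈ Metric.closedBall (0 : Orlicz N.dual m) (1 / 2),
      ∀ f ∈ Metric.closedBall (0 : Orlicz N m) (1 / 2), ‖orliczPairing N m w f‖ ≤ 2 := by
    intro w hw f hf
    rw [mem_closedBall_zero_iff] at hw hf
    have h2 := hN.orliczMod_le_norm (f := f) (by linarith)
    have h3 := hN'.orliczMod_le_norm (f := w) (by linarith)
    refine (norm_integral_le_of_norm_le ((hN.integrable_one f).add (hN'.integrable_one w))
      (Eventually.of_forall fun e => N.abs_mul_le _ _)).trans ?_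
    simp only [Pi.add_apply]
    rw [integral_add (hN.integrable_one f) (hN'.integrable_one w)]
    unfold orliczMod at h2 h3
    linarith
  have h4 : ∀ w ∈ Metric.closedBall (0 : Orlicz N.dual m) (1 / 2), ∀ f : Orlicz N m,
      ‖orliczPairing N m w f‖ ≤ 2 / (1 / 2) * ‖f‖ := fun w hw =>
    LinearMap.bound_of_ball_bound' (by norm_num) 2 (orliczPairing N m w) (h1 w hw)
  have h5 := LinearMap.bound_of_ball_bound' (by norm_num) (2 / (1 / 2) * ‖f‖)
    ((orliczPairing N m).flip f) (fun w hw => h4 w hw f) w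
  rw [LinearMap.flip_apply, Real.norm_eq_abs] at h5
  refine h5.trans (le_of_eq ?_)
  ring

/-- The extension of `L̄` to `L_{N*}` is `w ↦ -m(w ·)`. -/
def lbarExt (hN : DeltaTwo N m) (hN' : DeltaTwo N.dual m) :
    Orlicz N.dual m →L[ℝ] StrongDual ℝ (VSpace N S J) :=
  LinearMap.mkContinuous₂
    (-((orliczPairing N m).compl₂
      ({ toFun := VSpace.toLN, map_add' := VSpace.toLN_add, map_smul' := VSpace.toLN_smul } :
        VSpace N S J →ₗ[ℝ] Orlicz N m))) 8 fun w v => by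
    rw [LinearMap.neg_apply, LinearMap.neg_apply, norm_neg, LinearMap.compl₂_apply,
      Real.norm_eq_abs]
    refine (abs_orliczPairing_le hN hN' w _).trans ?_
    gcongr
    exact VSpace.norm_toLN_le v

theorem lbarExt_apply (hN : DeltaTwo N m) (hN' : DeltaTwo N.dual m) (w : Orlicz N.dual m)
    (v : VSpace N S J) : lbarExt hN hN' w v = -∫ e, (VSpace.toLN v).1 e * w.1 e ∂m := rfl

/-- The Riesz vector of `-𝓔(x,·)` is `-x`, so its inner product in `H` with `v` is the value of the
functional `v` at `-x`. By the definition of `V` this is `-m(v x)`. -/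
theorem extendsLbar_lbarExt (hN : DeltaTwo N m) (hN' : DeltaTwo N.dual m) :
    ExtendsLbar (lbarExt hN hN' : Orlicz N.dual m →L[ℝ] StrongDual ℝ (VSpace N S J)) := by
  intro x w hx
  ext v
  have hw : J x ∈ Orlicz N.dual m := by rw [hx]; exact w.2
  rw [lbarExt_apply, ← hx, ← VSpace.toH_apply v hw]
  change _ = inner ℝ ((InnerProductSpace.toDual ℝ (Fe S)).symm (-innerSL ℝ x))
    ((InnerProductSpace.toDual ℝ (Fe S)).symm (VSpace.toH v))
  have h1 : (InnerProductSpace.toDual ℝ (Fe S)).symm (-innerSL ℝ x) = -x := by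
    rw [map_neg, neg_inj, LinearIsometryEquiv.symm_apply_eq]
    rfl
  rw [h1, inner_neg_left, real_inner_comm, InnerProductSpace.toDual_symm_apply]

theorem ExtendsLbar.eq (hN1 : CondN1 N S J)
    {Λ Λ' : Orlicz N.dual m →L[ℝ] StrongDual ℝ (VSpace N S J)} (h : ExtendsLbar Λ)
    (h' : ExtendsLbar Λ') : Λ = Λ' := by
  refine ContinuousLinearMap.ext fun w => ?_
  refine congrFun (Continuous.ext_on hN1.dense_dual Λ.continuous Λ'.continuous ?_) w
  rintro w ⟨x, hx⟩
  rw [h x w hx, h' x w hx]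

end Duality

/-! ### Superposition operators from `L_N` to `L_{N*}` -/

section Nemytskii

variable {E : Type*} [MeasurableSpace E] {m : Measure E} {N : YoungFunction}

/-- The pointwise conditions on `s ↦ Ψ(t, s, ω)` for fixed `t` and `ω`. -/
structure MonotoneGrowth (N : YoungFunction) (c F : ℝ) (ψ : ℝ → ℝ) : Prop where
  cont : Continuous ψ
  mono : ∀ s₁ s₂, 0 ≤ (s₂ - s₁) * (ψ s₂ - ψ s₁)
  lower : ∀ s, N s - F ≤ s * ψ s
  upper : ∀ s, s * ψ s ≤ c * (N s + F)
  one_le : 1 ≤ c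
  nonneg : 0 ≤ F

namespace MonotoneGrowth

variable {c F : ℝ} {ψ : ℝ → ℝ}

/-- The supremum defining `N*` calls for a bound on `r|ψ(s)|`. Let `ψ(s) ≥ 0`. If `r ≤ s`, then
`rψ(s) ≤ sψ(s)`, which the growth bound at `s` controls. If `r > s`, monotonicity gives `rψ(s) ≤
rψ(r)`, and the growth bound at `r` yields a term `N(r)` that the supremum subtracts again. For
`ψ(s) ≤ 0` the comparison point is `-r`. -/
theorem dual_le (hψ : MonotoneGrowth N c F ψ) (s : ℝ) : N.dual (ψ s / c) ≤ N s + F := by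
  have hc : 0 < c := lt_of_lt_of_le one_pos hψ.one_le
  refine N.dualFun_le fun r hr => ?_
  have hF := hψ.nonneg
  have hs := N.nonneg' s
  have hNr := N.nonneg' r
  have key : r * |ψ s| ≤ c * (N r + F) ∨ r * |ψ s| ≤ c * (N s + F) := by
    rcases le_total 0 (ψ s) with h | h
    · rw [abs_of_nonneg h]
      rcases le_or_gt r s with hrs | hrs
      · right
        refine le_trans ?_ (hψ.upper s)
        gcongr
      · left
        refine le_trans ?_ (hψ.upper r)
        have := (mul_nonneg_iff_of_pos_left (sub_pos.2 hrs)).1 (hψ.mono s r)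
        nlinarith
    · rw [abs_of_nonpos h]
      rcases le_or_gt s (-r) with hrs | hrs
      · right
        refine le_trans ?_ (hψ.upper s)
        nlinarith
      · left
        have h1 := hψ.upper (-r)
        rw [N.even'] at h1
        refine le_trans ?_ h1
        have := (mul_nonneg_iff_of_pos_left (sub_pos.2 hrs)).1 (hψ.mono (-r) s)
        nlinarith
  rw [abs_div, abs_of_pos hc, ← mul_div_assoc]
  rcases key with h | h
  · have : r * |ψ s| / c ≤ N r + F := by rwa [div_le_iff₀' hc]
    linarith
  · have : r * |ψ s| / c ≤ N s + F := by rwa [div_le_iff₀' hc]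
    linarith

/-- Young's inequality for the pair `y` and `ψ(s)/c`. This bound is the domination behind both
integrability and hemicontinuity. -/
theorem abs_mul_le (hψ : MonotoneGrowth N c F ψ) (s y : ℝ) : |ψ s * y| ≤ c * (N s + N y + F) := by
  have hc : 0 < c := lt_of_lt_of_le one_pos hψ.one_le
  have h1 := N.abs_mul_le y (ψ s / c)
  have h2 := hψ.dual_le s
  have h3 : |ψ s * y| = c * |y * (ψ s / c)| := by
    rw [← mul_div_assoc, abs_div, abs_of_pos hc, mul_div_cancel₀ _ hc.ne', mul_comm]
  rw [h3]
  gcongr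
  linarith

theorem measurable_comp (hψ : MonotoneGrowth N c F ψ) (f : E →ₘ[m] ℝ) :
    AEStronglyMeasurable (fun e => ψ (f e)) m :=
  hψ.cont.comp_aestronglyMeasurable f.aestronglyMeasurable

theorem integrable_mul (hψ : MonotoneGrowth N c F ψ) (hN : DeltaTwo N m)
    (hF : Integrable (fun _ : E => F) m) (v u : Orlicz N m) :
    Integrable (fun e => ψ (v.1 e) * u.1 e) m := by
  refine ((((hN.integrable_one v).add (hN.integrable_one u)).add hF).const_mul c).mono'
    ((hψ.measurable_comp v.1).mul u.1.aestronglyMeasurable) (Eventually.of_forall fun e => ?_)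
  exact hψ.abs_mul_le _ _

theorem exists_orlicz_dual (hψ : MonotoneGrowth N c F ψ) (hN : DeltaTwo N m)
    (hF : Integrable (fun _ : E => F) m) (v : Orlicz N m) :
    ∃ w : Orlicz N.dual m, w.1 =ᵐ[m] fun e => ψ (v.1 e) := by
  have hc : 0 < c := lt_of_lt_of_le one_pos hψ.one_le
  have hw := AEEqFun.coeFn_mk _ (hψ.measurable_comp v.1)
  refine ⟨⟨AEEqFun.mk _ (hψ.measurable_comp v.1), mem_orlicz_of_integrable (inv_pos.2 hc) ?_⟩, hw⟩
  refine ((hN.integrable_one v).add hF).mono'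
    (N.dual.continuous'.comp_aestronglyMeasurable
      ((AEEqFun.aestronglyMeasurable _).const_mul c⁻¹)) ?_
  filter_upwards [hw] with e he
  rw [he, Real.norm_of_nonneg (N.dual.nonneg' _), ← div_eq_inv_mul]
  exact hψ.dual_le _

end MonotoneGrowth

/-- Hemicontinuity of superposition operators. -/
theorem continuous_integral_superposition (hN : DeltaTwo N m) {g : ℝ → ℝ} (hg : Continuous g)
    {K F : ℝ} (hK : 0 ≤ K) (hF : Integrable (fun _ : E => F) m)
    (hb : ∀ s y, |g s * y| ≤ K * (N s + N y + F)) (u v x : Orlicz N m) :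
    Continuous fun r : ℝ => ∫ e, g ((u + r • v).1 e) * x.1 e ∂m := by
  have heq : ∀ r : ℝ, (fun e => g ((u + r • v).1 e) * x.1 e) =ᵐ[m]
      fun e => g (u.1 e + r * v.1 e) * x.1 e := fun r => by
    filter_upwards [AEEqFun.coeFn_add u.1 (r • v.1), AEEqFun.coeFn_smul r v.1] with e h1 h2
    rw [Submodule.coe_add, Submodule.coe_smul, h1, Pi.add_apply, h2, Pi.smul_apply, smul_eq_mul]
  simp only [fun r => integral_congr_ae (heq r)]
  refine continuous_iff_continuousAt.2 fun r₀ => ?_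
  refine continuousAt_of_dominated
    -- A majorant valid for all `r` with `|r - r₀| < 1`: split `N` of the sum at the midpoint and
    -- use `|r| ≤ |r₀| + 1`. `Δ₂` makes every term integrable.
    (bound := fun e => K * (N (2 * u.1 e) + N (2 * (|r₀| + 1) * v.1 e) + N (x.1 e) + F))
    (Eventually.of_forall fun r => ?_) ?_ ?_ (Eventually.of_forall fun e => ?_)
  · exact (hg.comp_aestronglyMeasurable (u.1.aestronglyMeasurable.add
      (v.1.aestronglyMeasurable.const_mul r))).mul x.1.aestronglyMeasurable
  · filter_upwards [Metric.ball_mem_nhds r₀ one_pos] with r hr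
    refine Eventually.of_forall fun e => (hb _ _).trans ?_
    have h1 := N.add_le (u.1 e) (r * v.1 e)
    have h2 : N (2 * (r * v.1 e)) ≤ N (2 * (|r₀| + 1) * v.1 e) := by
      refine N.mono ?_
      rw [Metric.mem_ball, Real.dist_eq] at hr
      have h3 : |r| ≤ |(|r₀| + 1)| := by
        rw [abs_of_nonneg (by positivity : 0 ≤ |r₀| + 1)]
        linarith [abs_sub_abs_le_abs_sub r r₀]
      simp only [abs_mul, mul_assoc]
      gcongr
    gcongr
    linarith
  · exact ((((hN.integrable u 2).add (hN.integrable v _)).add (hN.integrable_one x)).add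
      hF).const_mul K
  · exact ((hg.comp (by fun_prop)).mul continuous_const).continuousAt

end Nemytskii

/-! ### The lower order term `m(Φ₀(v) L⁻¹ ·)` -/

section Perturbation

variable {E : Type*} [MeasurableSpace E] {m : Measure E} {N : YoungFunction}

/-- What the lower order term `m(Φ₀(t, v, ω) L⁻¹ ·)` has to satisfy for fixed `t` and `ω`. -/
structure PerturbationBounds (Linv : Orlicz N m →ₗ[ℝ] Orlicz N m) (ε₀ : ℝ) (ψ φ : ℝ → ℝ) :
    Prop where
  cont : Continuous φ
  dom : ∃ K : ℝ, 0 ≤ K ∧ ∀ s y, |φ s * y| ≤ K * (N s + N y)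
  self : ∀ v : Orlicz N m, |∫ e, φ (v.1 e) * (Linv v).1 e ∂m| ≤ ε₀ * orliczMod v
  growth : ∀ u v : Orlicz N m,
    |∫ e, φ (v.1 e) * (Linv u).1 e ∂m| ≤ orliczMod v + orliczMod u
  mono : ∀ u v : Orlicz N m,
    |∫ e, (φ (u.1 e) - φ (v.1 e)) * (Linv (u - v)).1 e ∂m| ≤
      ∫ e, (u.1 e - v.1 e) * (ψ (u.1 e) - ψ (v.1 e)) ∂m

namespace PerturbationBounds

variable {Linv : Orlicz N m →ₗ[ℝ] Orlicz N m} {ε₀ : ℝ} {ψ φ : ℝ → ℝ}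

theorem integrable_mul (hφ : PerturbationBounds Linv ε₀ ψ φ) (hN : DeltaTwo N m)
    (v u : Orlicz N m) : Integrable (fun e => φ (v.1 e) * u.1 e) m := by
  obtain ⟨K, -, hK⟩ := hφ.dom
  refine (((hN.integrable_one v).add (hN.integrable_one u)).const_mul K).mono'
    ((hφ.cont.comp_aestronglyMeasurable v.1.aestronglyMeasurable).mul u.1.aestronglyMeasurable)
    (Eventually.of_forall fun e => ?_)
  exact hK _ _

/-- The case (A1): no perturbation and no loss of coercivity. Monotonicity of `ψ` is needed only for
the sign of the right-hand side in `mono`. -/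
theorem of_eq_zero (hψ : ∀ s₁ s₂, 0 ≤ (s₂ - s₁) * (ψ s₂ - ψ s₁)) (hφ : ∀ s, φ s = 0) :
    PerturbationBounds Linv 0 ψ φ where
  cont := by simp only [funext hφ, continuous_const]
  dom := ⟨0, le_rfl, fun s y => by simp [hφ]⟩
  self v := by simp [hφ]
  growth u v := by
    simpa [hφ] using add_nonneg (orliczMod_nonneg v) (orliczMod_nonneg u)
  mono u v := by
    simpa [hφ] using integral_nonneg fun e => hψ (v.1 e) (u.1 e)

end PerturbationBounds

/-! ### Young functions that are sums of powers -/

section PowerSum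

variable {k : ℕ} {r : Fin k → ℝ≥0} {ε : Fin k → ℝ}

theorem mul_rpow_le_youngFunction (hε : ∀ i, 0 < ε i)
    (hNr : ∀ s : ℝ, N s = ∑ i, ε i * |s| ^ ((r i : ℝ) + 1)) (i : Fin k) (s : ℝ) :
    ε i * |s| ^ ((r i : ℝ) + 1) ≤ N s := by
  rw [hNr]
  exact Finset.single_le_sum (f := fun i => ε i * |s| ^ ((r i : ℝ) + 1))
    (fun j _ => mul_nonneg (hε j).le (by positivity)) (Finset.mem_univ i)

theorem integrable_abs_rpow (hε : ∀ i, 0 < ε i)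
    (hNr : ∀ s : ℝ, N s = ∑ i, ε i * |s| ^ ((r i : ℝ) + 1)) (hN : DeltaTwo N m) (i : Fin k)
    (f : Orlicz N m) : Integrable (fun e => |f.1 e| ^ ((r i : ℝ) + 1)) m := by
  refine ((hN.integrable_one f).const_mul (ε i)⁻¹).mono' ?_ (Eventually.of_forall fun e => ?_)
  · exact (continuous_abs.rpow_const fun _ => Or.inr (by positivity)).comp_aestronglyMeasurable
      f.1.aestronglyMeasurable
  · rw [Real.norm_of_nonneg (by positivity), ← div_eq_inv_mul, le_div_iff₀' (hε i)]
    exact mul_rpow_le_youngFunction hε hNr i _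

theorem orliczMod_eq_sum (hε : ∀ i, 0 < ε i)
    (hNr : ∀ s : ℝ, N s = ∑ i, ε i * |s| ^ ((r i : ℝ) + 1)) (hN : DeltaTwo N m)
    (f : Orlicz N m) :
    orliczMod f = ∑ i, ε i * ∫ e, |f.1 e| ^ ((r i : ℝ) + 1) ∂m := by
  unfold orliczMod
  simp only [hNr]
  rw [integral_finsetSum _ fun i _ => (integrable_abs_rpow hε hNr hN i f).const_mul _]
  simp only [integral_const_mul]

theorem memLp_orlicz (hε : ∀ i, 0 < ε i)
    (hNr : ∀ s : ℝ, N s = ∑ i, ε i * |s| ^ ((r i : ℝ) + 1)) (hN : DeltaTwo N m) (i : Fin k)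
    (f : Orlicz N m) : MemLp (f.1 : E → ℝ) ((r i : ℝ≥0∞) + 1) m := by
  rw [← integrable_norm_rpow_iff f.1.aestronglyMeasurable (by simp) (by simp)]
  have : ((r i : ℝ≥0∞) + 1).toReal = (r i : ℝ) + 1 := by
    rw [ENNReal.toReal_add (by simp) (by simp)]; simp
  simpa only [this, Real.norm_eq_abs] using integrable_abs_rpow hε hNr hN i f

theorem norm_rpow_eq_integral {r : ℝ≥0} (f : Lp ℝ ((r : ℝ≥0∞) + 1) m) :
    ‖f‖ ^ ((r : ℝ) + 1) = ∫ e, |f e| ^ ((r : ℝ) + 1) ∂m := by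
  have hr : ((r : ℝ≥0∞) + 1).toReal = (r : ℝ) + 1 := by
    rw [ENNReal.toReal_add (by simp) (by simp)]; simp
  rw [Lp.norm_def, (Lp.memLp f).eLpNorm_eq_integral_rpow_norm (by simp) (by simp), hr,
    ENNReal.toReal_ofReal (by positivity), Real.rpow_inv_rpow (by positivity) (by positivity)]
  simp only [Real.norm_eq_abs]

variable {L : Lp ℝ 2 m →ₗ.[ℝ] Lp ℝ 2 m} {Linv : Orlicz N m →ₗ[ℝ] Orlicz N m}
  {Q : ∀ i, Lp ℝ ((r i : ℝ≥0∞) + 1) m →L[ℝ] Lp ℝ ((r i : ℝ≥0∞) + 1) m}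

/-- On `L_N` the operator `Linv` coincides with `Q i`, so this is the operator norm bound raised to
the power `r i + 1`. -/
theorem IsInverse.integral_rpow_le (hQ : IsInverse L N r Q Linv) (hε : ∀ i, 0 < ε i)
    (hNr : ∀ s : ℝ, N s = ∑ i, ε i * |s| ^ ((r i : ℝ) + 1)) (hN : DeltaTwo N m) (i : Fin k)
    (f : Orlicz N m) :
    ∫ e, |(Linv f).1 e| ^ ((r i : ℝ) + 1) ∂m ≤
      ‖Q i‖ ^ ((r i : ℝ) + 1) * ∫ e, |f.1 e| ^ ((r i : ℝ) + 1) ∂m := by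
  have hf := memLp_orlicz hε hNr hN i f
  have h1 : ((hf.toLp _ : Lp ℝ ((r i : ℝ≥0∞) + 1) m) : E →ₘ[m] ℝ) = f.1 :=
    AEEqFun.ext hf.coeFn_toLp
  have h2 := hQ.restrict i f _ h1
  rw [← h1, ← h2, ← norm_rpow_eq_integral, ← norm_rpow_eq_integral,
    ← Real.mul_rpow (norm_nonneg _) (norm_nonneg _)]
  exact Real.rpow_le_rpow (norm_nonneg _) ((Q i).le_opNorm _) (by positivity)

/-- Young's inequality for `κᵢ m(|f|^{rᵢ} |L⁻¹ g|)`. -/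
theorem IsInverse.integral_mul_le (hQ : IsInverse L N r Q Linv) (hr : ∀ i, 0 < r i)
    (hε : ∀ i, 0 < ε i)
    (hNr : ∀ s : ℝ, N s = ∑ i, ε i * |s| ^ ((r i : ℝ) + 1)) (hN : DeltaTwo N m) (i : Fin k)
    (f g : Orlicz N m) :
    Integrable (fun e => ‖Q i‖⁻¹ * |f.1 e| ^ (r i : ℝ) * |(Linv g).1 e|) m ∧
    ∫ e, ‖Q i‖⁻¹ * |f.1 e| ^ (r i : ℝ) * |(Linv g).1 e| ∂m ≤
      (r i : ℝ) / (r i + 1) * ∫ e, |f.1 e| ^ ((r i : ℝ) + 1) ∂m +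
        1 / ((r i : ℝ) + 1) * ∫ e, |g.1 e| ^ ((r i : ℝ) + 1) ∂m := by
  have hri : (0 : ℝ) < r i := by exact_mod_cast hr i
  set p : ℝ := (r i : ℝ) + 1 with hp
  have hp0 : 0 < p := by positivity
  -- These exponents turn `|f|^r` into `|f|^(r+1)` and produce the weights `r/(r+1)` and `1/(r+1)`.
  have hconj : (p / r i).HolderConjugate p := by
    refine (Real.holderConjugate_iff).2 ⟨?_, ?_⟩
    · rw [lt_div_iff₀ hri]; linarith
    · rw [hp]; field_simp
  have hpt : ∀ e, ‖Q i‖⁻¹ * |f.1 e| ^ (r i : ℝ) * |(Linv g).1 e| ≤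
      (r i : ℝ) / p * |f.1 e| ^ p + 1 / p * (‖Q i‖⁻¹ ^ p * |(Linv g).1 e| ^ p) := fun e => by
    have h := Real.young_inequality_of_nonneg (a := |f.1 e| ^ (r i : ℝ))
      (b := ‖Q i‖⁻¹ * |(Linv g).1 e|) (by positivity) (by positivity) hconj
    rw [← Real.rpow_mul (abs_nonneg _), mul_div_cancel₀ _ hri.ne',
      Real.mul_rpow (by positivity) (abs_nonneg _)] at h
    calc _ = |f.1 e| ^ (r i : ℝ) * (‖Q i‖⁻¹ * |(Linv g).1 e|) := by ring
      _ ≤ _ := h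
      _ = _ := by field_simp
  have hif := integrable_abs_rpow hε hNr hN i f
  have hig := integrable_abs_rpow hε hNr hN i (Linv g)
  have hint : Integrable (fun e => (r i : ℝ) / p * |f.1 e| ^ p +
      1 / p * (‖Q i‖⁻¹ ^ p * |(Linv g).1 e| ^ p)) m :=
    (hif.const_mul _).add ((hig.const_mul _).const_mul _)
  have hleft : Integrable (fun e => ‖Q i‖⁻¹ * |f.1 e| ^ (r i : ℝ) * |(Linv g).1 e|) m := by
    refine hint.mono' ?_ (Eventually.of_forall fun e => ?_)
    · exact (((continuous_abs.rpow_const fun _ => Or.inr hri.le).comp_aestronglyMeasurable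
        f.1.aestronglyMeasurable).const_mul _).mul
        (continuous_abs.comp_aestronglyMeasurable (Linv g).1.aestronglyMeasurable)
    · rw [Real.norm_of_nonneg (by positivity)]
      exact hpt e
  refine ⟨hleft, (integral_mono hleft hint hpt).trans ?_⟩
  rw [integral_add (hif.const_mul _) ((hig.const_mul _).const_mul _), integral_const_mul,
    integral_const_mul, integral_const_mul]
  gcongr
  refine (mul_le_mul_of_nonneg_left (hQ.integral_rpow_le hε hNr hN i g) (by positivity)).trans ?_
  rw [← mul_assoc, ← Real.mul_rpow (by positivity) (norm_nonneg _)]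
  have h0 : 0 ≤ ∫ e, |g.1 e| ^ p ∂m := integral_nonneg fun e => by positivity
  -- Only the inequality holds in general: for `Q i = 0` the inverse is zero by convention.
  have h1 : ‖Q i‖⁻¹ * ‖Q i‖ ≤ 1 := inv_mul_le_one
  exact mul_le_of_le_one_left h0 (Real.rpow_le_one (by positivity) h1 hp0.le)

/-- The common source of the bounds `self`, `growth` and `mono`: they differ in the choice of `a`
(`ε₀ * ε i` or `δ i`) and of the functions `f` and `g`. -/
theorem IsInverse.abs_integral_le (hQ : IsInverse L N r Q Linv) (hr : ∀ i, 0 < r i)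
    (hε : ∀ i, 0 < ε i) (hNr : ∀ s : ℝ, N s = ∑ i, ε i * |s| ^ ((r i : ℝ) + 1))
    (hN : DeltaTwo N m) {a : Fin k → ℝ} (ha : ∀ i, 0 ≤ a i) (f g : Orlicz N m) {F : E → ℝ}
    (hF : ∀ᵐ e ∂m, |F e| ≤ ∑ i, a i * ‖Q i‖⁻¹ * |f.1 e| ^ (r i : ℝ)) :
    |∫ e, F e * (Linv g).1 e ∂m| ≤ ∑ i, a i *
      ((r i : ℝ) / (r i + 1) * ∫ e, |f.1 e| ^ ((r i : ℝ) + 1) ∂m +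
        1 / ((r i : ℝ) + 1) * ∫ e, |g.1 e| ^ ((r i : ℝ) + 1) ∂m) := by
  have hi := fun i => hQ.integral_mul_le hr hε hNr hN i f g
  rw [← Real.norm_eq_abs]
  refine (norm_integral_le_of_norm_le (g := fun e => ∑ i, a i *
    (‖Q i‖⁻¹ * |f.1 e| ^ (r i : ℝ) * |(Linv g).1 e|))
    (integrable_finsetSum _ fun i _ => (hi i).1.const_mul _) ?_).trans ?_
  · filter_upwards [hF] with e he
    rw [Real.norm_eq_abs, abs_mul]
    refine (mul_le_mul_of_nonneg_right he (abs_nonneg _)).trans (le_of_eq ?_)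
    rw [Finset.sum_mul]
    exact Finset.sum_congr rfl fun i _ => by ring
  · rw [integral_finsetSum _ fun i _ => (hi i).1.const_mul _]
    simp only [integral_const_mul]
    exact Finset.sum_le_sum fun i _ => mul_le_mul_of_nonneg_left (hi i).2 (ha i)

/-- For `f = g` the two Young weights add up to one, so no constant is lost: the increments of `φ`
are bounded by exactly the quantity that the strong monotonicity of `ψ` provides. -/
theorem IsInverse.perturbationBounds (hQ : IsInverse L N r Q Linv) (hr : ∀ i, 0 < r i)
    (hε : ∀ i, 0 < ε i) (hNr : ∀ s : ℝ, N s = ∑ i, ε i * |s| ^ ((r i : ℝ) + 1))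
    (hN : DeltaTwo N m) {δ : Fin k → ℝ} (hδ : ∀ i, 0 < δ i) {ε₀ : ℝ} (hε₀ : 0 < ε₀)
    (hε₁ : ε₀ < 1) {c F : ℝ} {ψ φ : ℝ → ℝ} (hF : Integrable (fun _ : E => F) m)
    (hψ : MonotoneGrowth N c F ψ) (hφ : Continuous φ)
    (hψδ : ∀ s₁ s₂ : ℝ, ∑ i, δ i * |s₂ - s₁| ^ ((r i : ℝ) + 1) ≤ (s₂ - s₁) * (ψ s₂ - ψ s₁))
    (hφδ : ∀ s₁ s₂ : ℝ, |φ s₂ - φ s₁| ≤ ∑ i, δ i * ‖Q i‖⁻¹ * |s₂ - s₁| ^ (r i : ℝ))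
    (hφε : ∀ s : ℝ, |φ s| ≤ ∑ i, (ε₀ * ‖Q i‖⁻¹ * ε i) * |s| ^ (r i : ℝ)) :
    PerturbationBounds Linv ε₀ ψ φ := by
  have hφε' : ∀ s : ℝ, |φ s| ≤ ∑ i, (ε₀ * ε i) * ‖Q i‖⁻¹ * |s| ^ (r i : ℝ) := fun s =>
    (hφε s).trans_eq (Finset.sum_congr rfl fun i _ => by ring)
  have hε0 : ∀ i, 0 ≤ ε₀ * ε i := fun i => (mul_pos hε₀ (hε i)).le
  have hr1 : ∀ i, (r i : ℝ) / (r i + 1) + 1 / ((r i : ℝ) + 1) = 1 := fun i => by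
    rw [← add_div, div_self (by positivity)]
  refine ⟨hφ, ⟨∑ i, ε₀ * ‖Q i‖⁻¹, by positivity, fun s y => ?_⟩, fun v => ?_, fun u v => ?_,
    fun u v => ?_⟩
  · rw [abs_mul]
    refine (mul_le_mul_of_nonneg_right (hφε s) (abs_nonneg y)).trans ?_
    rw [Finset.sum_mul, Finset.sum_mul]
    refine Finset.sum_le_sum fun i _ => ?_
    have h1 := mul_rpow_le_youngFunction hε hNr i s
    have h2 := mul_rpow_le_youngFunction hε hNr i y
    -- The larger of `|s|` and `|y|` can take the place of the other.
    have h3 : |s| ^ (r i : ℝ) * |y| ≤ |s| ^ ((r i : ℝ) + 1) + |y| ^ ((r i : ℝ) + 1) := by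
      have hs0 : 0 ≤ |s| ^ ((r i : ℝ) + 1) := by positivity
      have hy0 : 0 ≤ |y| ^ ((r i : ℝ) + 1) := by positivity
      have hsplit : ∀ x : ℝ, |x| ^ ((r i : ℝ) + 1) = |x| ^ (r i : ℝ) * |x| := fun x => by
        rw [Real.rpow_add_one' (abs_nonneg _) (by positivity)]
      rcases le_total |s| |y| with h | h
      · have : |s| ^ (r i : ℝ) * |y| ≤ |y| ^ ((r i : ℝ) + 1) := by
          rw [hsplit]; gcongr
        linarith
      · have : |s| ^ (r i : ℝ) * |y| ≤ |s| ^ ((r i : ℝ) + 1) := by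
          rw [hsplit]; gcongr
        linarith
    calc ε₀ * ‖Q i‖⁻¹ * ε i * |s| ^ (r i : ℝ) * |y|
        = ε₀ * ‖Q i‖⁻¹ * (ε i * (|s| ^ (r i : ℝ) * |y|)) := by ring
      _ ≤ ε₀ * ‖Q i‖⁻¹ * (ε i * (|s| ^ ((r i : ℝ) + 1) + |y| ^ ((r i : ℝ) + 1))) := by
          have := (hε i).le
          gcongr
      _ ≤ ε₀ * ‖Q i‖⁻¹ * (N s + N y) := by
          gcongr
          linarith
  · refine (hQ.abs_integral_le hr hε hNr hN hε0 v v
      (Eventually.of_forall fun e => hφε' _)).trans (le_of_eq ?_)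
    rw [orliczMod_eq_sum hε hNr hN, Finset.mul_sum]
    refine Finset.sum_congr rfl fun i _ => ?_
    rw [← add_mul, hr1, one_mul, mul_assoc]
  · refine (hQ.abs_integral_le hr hε hNr hN hε0 v u
      (Eventually.of_forall fun e => hφε' _)).trans ?_
    rw [orliczMod_eq_sum hε hNr hN, orliczMod_eq_sum hε hNr hN, ← Finset.sum_add_distrib]
    refine Finset.sum_le_sum fun i _ => ?_
    have hv : 0 ≤ ∫ e, |v.1 e| ^ ((r i : ℝ) + 1) ∂m := integral_nonneg fun e => by positivity
    have hu : 0 ≤ ∫ e, |u.1 e| ^ ((r i : ℝ) + 1) ∂m := integral_nonneg fun e => by positivity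
    have h1 : (r i : ℝ) / (r i + 1) ≤ 1 := by
      rw [div_le_one (by positivity)]; linarith
    have h2 : 1 / ((r i : ℝ) + 1) ≤ 1 := by
      rw [div_le_one (by positivity)]; linarith [(r i).coe_nonneg]
    rw [← mul_add]
    have hεi := (hε i).le
    have h3 : ε₀ * ε i ≤ ε i := mul_le_of_le_one_left hεi hε₁.le
    calc _ ≤ ε₀ * ε i * (1 * (∫ e, |v.1 e| ^ ((r i : ℝ) + 1) ∂m) +
          1 * ∫ e, |u.1 e| ^ ((r i : ℝ) + 1) ∂m) := by gcongr
      _ ≤ _ := by rw [one_mul, one_mul]; gcongr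
  · have hsub : ∀ᵐ e ∂m, (u - v).1 e = u.1 e - v.1 e := by
      filter_upwards [AEEqFun.coeFn_sub u.1 v.1] with e he
      rw [Submodule.coe_sub, he, Pi.sub_apply]
    -- Both functions are `u - v` here, with `a = δ`. What remains is `∑ δᵢ |u - v|^(rᵢ+1)`,
    -- integrated, which lies below the monotonicity integral of `ψ`.
    refine (hQ.abs_integral_le hr hε hNr hN (fun i => (hδ i).le) (u - v) (u - v)
      (hsub.mono fun e he => by rw [he]; exact hφδ _ _)).trans ?_
    have hI := fun i => integrable_abs_rpow hε hNr hN i (u - v)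
    have h1 : ∑ i, δ i * ((r i : ℝ) / (r i + 1) * ∫ e, |(u - v).1 e| ^ ((r i : ℝ) + 1) ∂m +
        1 / ((r i : ℝ) + 1) * ∫ e, |(u - v).1 e| ^ ((r i : ℝ) + 1) ∂m) =
        ∫ e, ∑ i, δ i * |(u - v).1 e| ^ ((r i : ℝ) + 1) ∂m := by
      rw [integral_finsetSum _ fun i _ => (hI i).const_mul _]
      refine Finset.sum_congr rfl fun i _ => ?_
      rw [integral_const_mul, ← add_mul, hr1, one_mul]
    rw [h1]
    refine integral_mono_ae (integrable_finsetSum _ fun i _ => (hI i).const_mul _) ?_ ?_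
    · have h2 := (hψ.integrable_mul hN hF u (u - v)).sub (hψ.integrable_mul hN hF v (u - v))
      refine h2.congr ?_
      filter_upwards [hsub] with e he
      rw [Pi.sub_apply, he]; ring
    · filter_upwards [hsub] with e he
      simp only [he]
      exact hψδ _ _

end PowerSum

end Perturbation

/-! ### The drift operator and its bounds -/

section Drift

variable {E : Type*} [MeasurableSpace E] {m : Measure E} {N : YoungFunction}
  {S : Lp ℝ 2 m →ₗ.[ℝ] Lp ℝ 2 m} {J : Fe S →ₗ[ℝ] (E →ₘ[m] ℝ)}
  {Ω : Type*} {mΩ : MeasurableSpace Ω} {P : Measure Ω} {ℱ : Filtration ℝ≥0 mΩ} {T : ℝ≥0}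
  {Ψ Φ Φ₀ : ℝ → ℝ → Ω → ℝ} {h : ℝ → Ω → ℝ} {Linv : Orlicz N m →ₗ[ℝ] Orlicz N m}

/-- The common consequences of (A1) and (A2) from which (H1)-(H4) follow. -/
structure DriftBounds (ℱ : Filtration ℝ≥0 mΩ) (P : Measure Ω) (T : ℝ≥0)
    (Linv : Orlicz N m →ₗ[ℝ] Orlicz N m) (Ψ Φ₀ : ℝ → ℝ → Ω → ℝ) (h : ℝ → Ω → ℝ)
    (C c ε₀ : ℝ) (f : ℝ → Ω → ℝ) : Prop where
  h_le : ∀ t ∈ Icc (0 : ℝ) T, ∀ ω, |h t ω| ≤ C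
  f_adapted : AdaptedL1 ℱ P T f
  psi : ∀ t ∈ Icc (0 : ℝ) T, ∀ ω,
    MonotoneGrowth N c (f t ω * finInd m) (fun s => Ψ t s ω)
  lt_one : ε₀ < 1
  phi : ∀ t ∈ Icc (0 : ℝ) T, ∀ ω,
    PerturbationBounds Linv ε₀ (fun s => Ψ t s ω) (fun s => Φ₀ t s ω)

theorem CondA1.exists_driftBounds (hA : CondA1 ℱ P T N m Ψ Φ h Φ₀)
    (hΨc : ∀ t : ℝ, 0 ≤ t → ∀ ω, Continuous fun s => Ψ t s ω) :
    ∃ (C c ε₀ : ℝ) (f : ℝ → Ω → ℝ), DriftBounds ℱ P T Linv Ψ Φ₀ h C c ε₀ f := by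
  obtain ⟨C, hC⟩ := hA.h_bdd.bounded
  obtain ⟨f, c, hf, hf0, hc, hb⟩ := hA.psi
  refine ⟨C, c, 0, f, hC, hf, fun t ht ω => ?_, one_pos, fun t ht ω => ?_⟩
  · obtain ⟨h1, h2, h3⟩ := hb t ht ω
    simp only [mul_comm (finInd m)] at h2 h3
    exact ⟨hΨc t ht.1 ω, h1, h2, h3, hc, mul_nonneg (hf0 t ht ω) (finInd_nonneg m)⟩
  · exact PerturbationBounds.of_eq_zero (hb t ht ω).1 fun s => hA.phi_zero t ht s ω

theorem CondA2.exists_driftBounds {L : Lp ℝ 2 m →ₗ.[ℝ] Lp ℝ 2 m}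
    (hA : CondA2 ℱ P T N L Linv Ψ Φ h Φ₀) (hN : DeltaTwo N m)
    (hΨc : ∀ t : ℝ, 0 ≤ t → ∀ ω, Continuous fun s => Ψ t s ω)
    (hΦc : ∀ t : ℝ, 0 ≤ t → ∀ ω, Continuous fun s => Φ t s ω) :
    ∃ (C c ε₀ : ℝ) (f : ℝ → Ω → ℝ), DriftBounds ℱ P T Linv Ψ Φ₀ h C c ε₀ f := by
  obtain ⟨C, hC⟩ := hA.h_bdd.bounded
  obtain ⟨k, r, ε, δ, Q, -, hr, hε, hδ, hNr, hQ, ⟨f, c, hf, hf0, hc, hb⟩, hφδ, ε₀, hε₀, hε₁, hφε⟩ :=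
    hA.exponents
  -- (A2) only has `c ≥ 0`; passing to `max c 1` makes the division by `c` in the dual estimate
  -- legitimate.
  have hψ : ∀ t ∈ Icc (0 : ℝ) T, ∀ ω,
      MonotoneGrowth N (max c 1) (f t ω * finInd m) (fun s => Ψ t s ω) := fun t ht ω => by
    obtain ⟨h1, h2, h3⟩ := hb t ht ω
    have hF := mul_nonneg (hf0 t ht ω) (finInd_nonneg m)
    refine ⟨hΨc t ht.1 ω, fun s₁ s₂ => (Finset.sum_nonneg fun i _ => ?_).trans (h1 s₁ s₂), h2,
      fun s => (h3 s).trans ?_, le_max_right _ _, hF⟩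
    · exact mul_nonneg (hδ i).le (by positivity)
    · exact mul_le_mul_of_nonneg_right (le_max_left _ _) (add_nonneg (N.nonneg' s) hF)
  refine ⟨C, max c 1, ε₀, f, hC, hf, hψ, hε₁, fun t ht ω => ?_⟩
  have hφ : Continuous fun s => Φ₀ t s ω := by
    have h1 : (fun s => Φ₀ t s ω) = fun s => Φ t s ω - h t ω * s := by
      funext s; rw [hA.phi_eq t ht s ω]; ring
    rw [h1]
    exact (hΦc t ht.1 ω).sub (by fun_prop)
  exact hQ.perturbationBounds hr hε hNr hN hδ hε₀ hε₁ (integrable_finInd m (f t ω)) (hψ t ht ω) hφ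
    (hb t ht ω).1 (fun s₁ s₂ => hφδ t ht s₁ s₂ ω) (fun s => hφε t ht s ω)

theorem hToVDual_apply (a : GreenSpace S) (v : VSpace N S J) :
    hToVDual N S J a v = inner ℝ a (VSpace.toH v) := rfl

theorem GreenSpace.inner_smul_left (c : ℝ) (a b : GreenSpace S) :
    inner ℝ (c • a) b = c * inner ℝ a b :=
  real_inner_smul_left a b c

/-- The functional `u ↦ m(φ(v) L⁻¹ u)` on `V`. -/
theorem PerturbationBounds.exists_functional {ε₀ : ℝ} {ψ φ : ℝ → ℝ}
    (hφ : PerturbationBounds Linv ε₀ ψ φ) (hN : DeltaTwo N m) (v : Orlicz N m) :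
    ∃ a : StrongDual ℝ (VSpace N S J), ∀ u,
      a u = ∫ e, φ (v.1 e) * (Linv (VSpace.toLN u)).1 e ∂m := by
  have hi := fun u => hφ.integrable_mul hN v u
  let a : VSpace N S J →ₗ[ℝ] ℝ :=
    { toFun := fun u => ∫ e, φ (v.1 e) * (Linv (VSpace.toLN u)).1 e ∂m
      map_add' := fun u u' => by
        rw [← integral_add (hi _) (hi _), VSpace.toLN_add, map_add]
        refine integral_congr_ae ?_
        filter_upwards [AEEqFun.coeFn_add (Linv (VSpace.toLN u)).1 (Linv (VSpace.toLN u')).1]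
          with e he
        rw [Submodule.coe_add, he, Pi.add_apply, mul_add]
      map_smul' := fun c u => by
        rw [RingHom.id_apply, smul_eq_mul, ← integral_const_mul, VSpace.toLN_smul, map_smul]
        refine integral_congr_ae ?_
        filter_upwards [AEEqFun.coeFn_smul c (Linv (VSpace.toLN u)).1] with e he
        rw [Submodule.coe_smul, he, Pi.smul_apply, smul_eq_mul]; ring }
  -- No norm bound for `Linv` on `L_N` is at hand. Continuity comes instead from the modular bound
  -- `growth`: on the ball of radius `1 / 2` the modular of `u` is at most one.
  have hb := LinearMap.bound_of_ball_bound' (by norm_num : (0 : ℝ) < 1 / 2) (orliczMod v + 1) a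
    fun u hu => by
      rw [mem_closedBall_zero_iff] at hu
      have h1 := VSpace.norm_toLN_le u
      have h2 := hN.orliczMod_le_norm (f := VSpace.toLN u) (by linarith)
      refine (hφ.growth (VSpace.toLN u) v).trans ?_
      linarith
  exact ⟨a.mkContinuous _ hb, fun u => rfl⟩

variable {C c ε₀ : ℝ} {f : ℝ → Ω → ℝ}

theorem DriftBounds.exists_isDrift (hD : DriftBounds ℱ P T Linv Ψ Φ₀ h C c ε₀ f)
    (hN : DeltaTwo N m) (Λ : Orlicz N.dual m →L[ℝ] StrongDual ℝ (VSpace N S J)) :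
    ∃ A : ℝ → VSpace N S J → Ω → StrongDual ℝ (VSpace N S J), IsDrift T Λ Linv Ψ h Φ₀ A := by
  have key : ∀ t ∈ Icc (0 : ℝ) T, ∀ (v : VSpace N S J) (ω : Ω),
      ∃ a : StrongDual ℝ (VSpace N S J), ∃ w : Orlicz N.dual m,
      w.1 =ᵐ[m] (fun e => Ψ t ((VSpace.toLN v).1 e) ω) ∧ ∀ u : VSpace N S J,
      Integrable (fun e => Φ₀ t ((VSpace.toLN v).1 e) ω * (Linv (VSpace.toLN u)).1 e) m ∧
      a u = Λ w u + hToVDual N S J (h t ω • VSpace.toH v) u -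
        ∫ e, Φ₀ t ((VSpace.toLN v).1 e) ω * (Linv (VSpace.toLN u)).1 e ∂m := by
    intro t ht v ω
    obtain ⟨w, hw⟩ := (hD.psi t ht ω).exists_orlicz_dual hN (integrable_finInd m _) (VSpace.toLN v)
    obtain ⟨a, ha⟩ := (hD.phi t ht ω).exists_functional (S := S) (J := J) hN (VSpace.toLN v)
    refine ⟨Λ w + hToVDual N S J (h t ω • VSpace.toH v) - a, w, hw, fun u =>
      ⟨(hD.phi t ht ω).integrable_mul hN _ _, ?_⟩⟩
    rw [sub_apply, add_apply, ha]
  -- The choice pins `A` down only for times in `[0,T]`, which is all that `IsDrift` asks for.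
  choose! A hA using key
  exact ⟨A, hA⟩

variable {A : ℝ → VSpace N S J → Ω → StrongDual ℝ (VSpace N S J)}

/-- The representative `w` of `Ψ(v)` enters through an integral only, so it can be replaced by
`Ψ(v)` itself. -/
theorem IsDrift.apply {hN : DeltaTwo N m} {hN' : DeltaTwo N.dual m}
    (hA : IsDrift T (lbarExt hN hN') Linv Ψ h Φ₀ A) {t : ℝ} (ht : t ∈ Icc (0 : ℝ) T)
    (v : VSpace N S J) (ω : Ω) (u : VSpace N S J) :
    A t v ω u = -∫ e, Ψ t ((VSpace.toLN v).1 e) ω * (VSpace.toLN u).1 e ∂m +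
      h t ω * inner ℝ (VSpace.toH v) (VSpace.toH u) -
        ∫ e, Φ₀ t ((VSpace.toLN v).1 e) ω * (Linv (VSpace.toLN u)).1 e ∂m := by
  obtain ⟨w, hw, hu⟩ := hA t ht v ω
  rw [(hu u).2, lbarExt_apply, hToVDual_apply, GreenSpace.inner_smul_left]
  congr 3
  refine integral_congr_ae ?_
  filter_upwards [hw] with e he
  rw [he, mul_comm]

variable {hN : DeltaTwo N m} {hN' : DeltaTwo N.dual m}

theorem DriftBounds.condH1 (hD : DriftBounds ℱ P T Linv Ψ Φ₀ h C c ε₀ f)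
    (hA : IsDrift T (lbarExt hN hN') Linv Ψ h Φ₀ A) : CondH1 T A := by
  intro u v x ω t ht
  have hψ := hD.psi t ht ω
  obtain ⟨K, hK, hφ⟩ := (hD.phi t ht ω).dom
  have h1 := continuous_integral_superposition hN hψ.cont (zero_le_one.trans hψ.one_le)
    (integrable_finInd m _) hψ.abs_mul_le (VSpace.toLN u) (VSpace.toLN v) (VSpace.toLN x)
  have h2 := continuous_integral_superposition (F := 0) hN (hD.phi t ht ω).cont hK
    (by simp) (by simpa using hφ) (VSpace.toLN u) (VSpace.toLN v) (Linv (VSpace.toLN x))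
  have h3 : Continuous fun r : ℝ =>
      h t ω * inner ℝ (VSpace.toH (u + r • v)) (VSpace.toH x) := by
    simp only [map_add, map_smul, inner_add_left, GreenSpace.inner_smul_left]
    fun_prop
  simp only [hA.apply ht]
  exact (h1.neg.add h3).sub h2

/-- The term with `Ψ` is minus the monotonicity integral, and `mono` says that it outweighs the term
with `Φ₀`. Only the part with `h`, bounded by `C`, is left. -/
theorem DriftBounds.monotone (hD : DriftBounds ℱ P T Linv Ψ Φ₀ h C c ε₀ f)
    (hA : IsDrift T (lbarExt hN hN') Linv Ψ h Φ₀ A) {t : ℝ} (ht : t ∈ Icc (0 : ℝ) T) (ω : Ω)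
    (u v : VSpace N S J) :
    (A t u ω - A t v ω) (u - v) ≤ C * ‖VSpace.toH (u - v)‖ ^ 2 := by
  have hψ := hD.psi t ht ω
  have hφ := hD.phi t ht ω
  have hF := integrable_finInd m (f t ω)
  have h1 : ∫ e, (Ψ t ((VSpace.toLN u).1 e) ω) * (VSpace.toLN (u - v)).1 e ∂m -
      ∫ e, (Ψ t ((VSpace.toLN v).1 e) ω) * (VSpace.toLN (u - v)).1 e ∂m =
      ∫ e, ((VSpace.toLN u).1 e - (VSpace.toLN v).1 e) *
        (Ψ t ((VSpace.toLN u).1 e) ω - Ψ t ((VSpace.toLN v).1 e) ω) ∂m := by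
    rw [← integral_sub (hψ.integrable_mul hN hF _ _) (hψ.integrable_mul hN hF _ _)]
    refine integral_congr_ae ?_
    filter_upwards [AEEqFun.coeFn_sub (VSpace.toLN u).1 (VSpace.toLN v).1] with e he
    rw [VSpace.toLN_sub, Submodule.coe_sub, he, Pi.sub_apply]; ring
  have h2 : ∫ e, (Φ₀ t ((VSpace.toLN u).1 e) ω) * (Linv (VSpace.toLN (u - v))).1 e ∂m -
      ∫ e, (Φ₀ t ((VSpace.toLN v).1 e) ω) * (Linv (VSpace.toLN (u - v))).1 e ∂m =
      ∫ e, (Φ₀ t ((VSpace.toLN u).1 e) ω - Φ₀ t ((VSpace.toLN v).1 e) ω) *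
        (Linv (VSpace.toLN u - VSpace.toLN v)).1 e ∂m := by
    rw [← integral_sub (hφ.integrable_mul hN _ _) (hφ.integrable_mul hN _ _), VSpace.toLN_sub]
    exact integral_congr_ae (Eventually.of_forall fun e => by simp only; ring)
  have h3 : inner ℝ (VSpace.toH u) (VSpace.toH (u - v)) -
      inner ℝ (VSpace.toH v) (VSpace.toH (u - v)) = ‖VSpace.toH (u - v)‖ ^ 2 := by
    rw [← inner_sub_left, ← map_sub, real_inner_self_eq_norm_sq]
  have h4 := (abs_le.1 (hφ.mono (VSpace.toLN u) (VSpace.toLN v))).1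
  have h5 : h t ω * ‖VSpace.toH (u - v)‖ ^ 2 ≤ C * ‖VSpace.toH (u - v)‖ ^ 2 := by
    gcongr
    exact (le_abs_self _).trans (hD.h_le t ht ω)
  rw [sub_apply, hA.apply ht, hA.apply ht]
  rw [← h3, mul_sub] at h5
  rw [← h1, ← h2] at h4
  rw [← h3]
  linarith

/-- The lower bound on `sΨ(s)` yields a full modular up to the integrated error, of which `Φ₀`
consumes at most the fraction `ε₀`. -/
theorem DriftBounds.coercive (hD : DriftBounds ℱ P T Linv Ψ Φ₀ h C c ε₀ f)
    (hA : IsDrift T (lbarExt hN hN') Linv Ψ h Φ₀ A) {t : ℝ} (ht : t ∈ Icc (0 : ℝ) T) (ω : Ω)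
    (v : VSpace N S J) :
    A t v ω v ≤ -(1 - ε₀) * orliczMod (VSpace.toLN v) + C * ‖VSpace.toH v‖ ^ 2 +
      finInd m * m.real univ * f t ω := by
  have hψ := hD.psi t ht ω
  have hF := integrable_finInd m (f t ω)
  have h1 : orliczMod (VSpace.toLN v) - finInd m * m.real univ * f t ω ≤
      ∫ e, Ψ t ((VSpace.toLN v).1 e) ω * (VSpace.toLN v).1 e ∂m := by
    have h2 : orliczMod (VSpace.toLN v) - finInd m * m.real univ * f t ω =
        ∫ e, (N ((VSpace.toLN v).1 e) - f t ω * finInd m) ∂m := by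
      rw [integral_sub (hN.integrable_one _) hF, integral_const, smul_eq_mul, orliczMod]
      ring
    rw [h2]
    refine integral_mono ((hN.integrable_one _).sub hF) (hψ.integrable_mul hN hF _ _) fun e => ?_
    simp only
    rw [mul_comm (Ψ t _ ω)]
    exact hψ.lower _
  have h3 := (abs_le.1 ((hD.phi t ht ω).self (VSpace.toLN v))).1
  have h4 : h t ω * ‖VSpace.toH v‖ ^ 2 ≤ C * ‖VSpace.toH v‖ ^ 2 := by
    gcongr
    exact (le_abs_self _).trans (hD.h_le t ht ω)
  rw [hA.apply ht, real_inner_self_eq_norm_sq]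
  linarith

/-- The three summands of the constant stem from the terms with `Ψ` (Young), `h` (Cauchy-Schwarz)
and `Φ₀`. -/
theorem DriftBounds.growth (hD : DriftBounds ℱ P T Linv Ψ Φ₀ h C c ε₀ f)
    (hA : IsDrift T (lbarExt hN hN') Linv Ψ h Φ₀ A) {t : ℝ} (ht : t ∈ Icc (0 : ℝ) T) (ω : Ω)
    (u v : VSpace N S J) :
    |A t v ω u| ≤ c * finInd m * m.real univ * f t ω +
      (|c| + |C| + 1) * (RFun N S J v + RFun N S J u) := by
  have hψ := hD.psi t ht ω
  have hF := integrable_finInd m (f t ω)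
  have hc : 0 < c := zero_lt_one.trans_le hψ.one_le
  have h1 : |∫ e, Ψ t ((VSpace.toLN v).1 e) ω * (VSpace.toLN u).1 e ∂m| ≤
      c * (orliczMod (VSpace.toLN v) + orliczMod (VSpace.toLN u) +
        finInd m * m.real univ * f t ω) := by
    have hvu := (hN.integrable_one (VSpace.toLN v)).add (hN.integrable_one (VSpace.toLN u))
    rw [← Real.norm_eq_abs]
    refine (norm_integral_le_of_norm_le ((hvu.add hF).const_mul c)
      (Eventually.of_forall fun e => hψ.abs_mul_le _ _)).trans (le_of_eq ?_)
    rw [integral_const_mul, integral_add' hvu hF,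
      integral_add' (hN.integrable_one _) (hN.integrable_one _), integral_const, smul_eq_mul]
    unfold orliczMod
    ring
  have h2 : |h t ω * inner ℝ (VSpace.toH v) (VSpace.toH u)| ≤
      |C| * (‖VSpace.toH v‖ ^ 2 + ‖VSpace.toH u‖ ^ 2) := by
    rw [abs_mul]
    refine mul_le_mul ((hD.h_le t ht ω).trans (le_abs_self C)) ?_ (abs_nonneg _) (abs_nonneg _)
    refine (abs_real_inner_le_norm _ _).trans ?_
    nlinarith [sq_nonneg (‖VSpace.toH v‖ - ‖VSpace.toH u‖), sq_nonneg ‖VSpace.toH v‖,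
      sq_nonneg ‖VSpace.toH u‖]
  have h3 := (hD.phi t ht ω).growth (VSpace.toLN u) (VSpace.toLN v)
  have h4 : ∀ a b d : ℝ, |-a + b - d| ≤ |a| + |b| + |d| := fun a b d => by
    refine (abs_sub _ _).trans ?_
    have := abs_add_le (-a) b
    rw [abs_neg] at this
    linarith
  rw [hA.apply ht, abs_of_pos hc]
  refine (h4 _ _ _).trans ?_
  rw [RFun_eq, RFun_eq]
  have hv := orliczMod_nonneg (VSpace.toLN v)
  have hu := orliczMod_nonneg (VSpace.toLN u)
  have hv2 := sq_nonneg ‖VSpace.toH v‖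
  have hu2 := sq_nonneg ‖VSpace.toH u‖
  have h5 : 0 ≤ (c + 1) * (‖VSpace.toH v‖ ^ 2 + ‖VSpace.toH u‖ ^ 2) := by positivity
  have h6 : 0 ≤ |C| * (orliczMod (VSpace.toLN v) + orliczMod (VSpace.toLN u)) := by positivity
  linarith

theorem AdaptedL1.const_mul {f : ℝ → Ω → ℝ} (hf : AdaptedL1 ℱ P T f) (a : ℝ) :
    AdaptedL1 ℱ P T fun t ω => a * f t ω :=
  ⟨fun t ht => (hf.1 t ht).const_mul a, hf.2.const_mul a⟩

theorem AdaptedL1.add {f g : ℝ → Ω → ℝ} (hf : AdaptedL1 ℱ P T f) (hg : AdaptedL1 ℱ P T g) :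
    AdaptedL1 ℱ P T fun t ω => f t ω + g t ω :=
  ⟨fun t ht => (hf.1 t ht).add (hg.1 t ht), hf.2.add hg.2⟩

/-- The squared norm of a progressively measurable, square integrable coefficient at a fixed
point. -/
theorem adaptedL1_norm_sq {Y Z : Type*} [TopologicalSpace Y] [NormedAddCommGroup Z]
    {B : ℝ → Y → Ω → Z} (hB : ∀ t : ℝ≥0, t ≤ T → ProgMeasAt ℱ t B) (y : Y)
    (hB0 : MemLp (fun p : ℝ × Ω => B p.1 y p.2) 2 (timeProb T P)) :
    AdaptedL1 ℱ P T fun t ω => ‖B t y ω‖ ^ 2 := by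
  refine ⟨fun t ht => ?_, by simpa using hB0.integrable_norm_pow two_ne_zero⟩
  let : MeasurableSpace Z := borel Z
  have : BorelSpace Z := ⟨rfl⟩
  -- The time is frozen at the right endpoint of `[0,t]`, so progressive measurability at `t` gives
  -- `ℱ t`-measurability.
  have h1 := (@measurable_prodMk_left (Icc (0 : ℝ) t) (Y × Ω) inferInstance
    (@Prod.instMeasurableSpace _ _ (borel Y) (ℱ t)) ⟨t, t.2, le_rfl⟩).comp
    (@measurable_prodMk_left Y Ω (borel Y) (ℱ t) y)
  have h2 : Measurable fun z : Z => ‖z‖ ^ 2 := measurable_norm.pow_const 2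
  exact h2.comp ((hB t ht).comp h1)

end Drift

end PorousMedia

end

/-! ### Assembly of the proposition -/

theorem proposition3p8
    {E : Type*} [MeasurableSpace E] [MeasurableSpace.CountablyGenerated E]
    (m : Measure E) [SigmaFinite m]
    (L S : Lp ℝ 2 m →ₗ.[ℝ] Lp ℝ 2 m)
    (hL : PorousMedia.IsNegSelfAdjoint L) (hS : PorousMedia.IsSqrtNeg S L)
    (J : PorousMedia.Fe S →ₗ[ℝ] (E →ₘ[m] ℝ)) (hL1 : PorousMedia.CondL1 S J)
    (N : PorousMedia.YoungFunction)
    (hN : PorousMedia.DeltaTwo N m) (hN' : PorousMedia.DeltaTwo N.dual m)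
    (hN1 : PorousMedia.CondN1 N S J) (hN2 : PorousMedia.CondN2 N S J)
    {Ω : Type*} [mΩ : MeasurableSpace Ω] (P : Measure Ω) [IsProbabilityMeasure P]
    (ℱ : Filtration ℝ≥0 mΩ) (T : ℝ≥0) (hT : 0 < T)
    {G ι : Type*} [NormedAddCommGroup G] [InnerProductSpace ℝ G] [CompleteSpace G] [Countable ι]
    (b : HilbertBasis ι ℝ G)
    (Ψ Φ Φ₀ : ℝ → ℝ → Ω → ℝ) (h : ℝ → Ω → ℝ)
    (hΨ : ∀ t : ℝ≥0, PorousMedia.ProgMeasAt ℱ t Ψ) (hΦ : ∀ t : ℝ≥0, PorousMedia.ProgMeasAt ℱ t Φ)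
    (hΨc : ∀ t : ℝ, 0 ≤ t → ∀ ω, Continuous fun s => Ψ t s ω)
    (hΦc : ∀ t : ℝ, 0 ≤ t → ∀ ω, Continuous fun s => Φ t s ω)
    (Linv : PorousMedia.Orlicz N m →ₗ[ℝ] PorousMedia.Orlicz N m)
    (hA : PorousMedia.CondA1 ℱ P T N m Ψ Φ h Φ₀ ∨ PorousMedia.CondA2 ℱ P T N L Linv Ψ Φ h Φ₀)
    (B : ℝ → PorousMedia.VSpace N S J → Ω → PorousMedia.HS b (PorousMedia.GreenSpace S))
    (hB : ∀ t : ℝ≥0, t ≤ T → PorousMedia.ProgMeasAt ℱ t B)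
    (hBLip : PorousMedia.CondH2 (H := PorousMedia.GreenSpace S) T PorousMedia.VSpace.toH (fun _ _ _ => 0) B)
    (hB0 : MemLp (fun p : ℝ × Ω => B p.1 0 p.2) 2 (PorousMedia.timeProb T P)) :
    (∀ v : PorousMedia.VSpace N S J, Integrable (fun e => N ((PorousMedia.VSpace.toLN v).1 e)) m) ∧
    PorousMedia.CondK (PorousMedia.timeProb T P)
      (PorousMedia.KSpace.eval : PorousMedia.KSpace N S J T P → _)
      (PorousMedia.RFun N S J) ∧
    (∃! Λ : PorousMedia.Orlicz N.dual m →L[ℝ] StrongDual ℝ (PorousMedia.VSpace N S J),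
      PorousMedia.ExtendsLbar Λ) ∧
    ∀ Λ : PorousMedia.Orlicz N.dual m →L[ℝ] StrongDual ℝ (PorousMedia.VSpace N S J),
      PorousMedia.ExtendsLbar Λ →
      ∃ A : ℝ → PorousMedia.VSpace N S J → Ω → StrongDual ℝ (PorousMedia.VSpace N S J),
        PorousMedia.IsDrift T Λ Linv Ψ h Φ₀ A ∧
        PorousMedia.CondH1 T A ∧
        PorousMedia.CondH2 (H := PorousMedia.GreenSpace S) T PorousMedia.VSpace.toH A B ∧
        PorousMedia.CondH3 (H := PorousMedia.GreenSpace S) ℱ P T PorousMedia.VSpace.toH (PorousMedia.RFun N S J) A B ∧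
        PorousMedia.CondH4 ℱ P T (PorousMedia.RFun N S J) A := by
  have hD : ∃ (C c ε₀ : ℝ) (f : ℝ → Ω → ℝ),
      PorousMedia.DriftBounds ℱ P T Linv Ψ Φ₀ h C c ε₀ f :=
    hA.elim (fun hA => hA.exists_driftBounds hΨc) fun hA => hA.exists_driftBounds hN hΨc hΦc
  obtain ⟨C, c, ε₀, f, hD⟩ := hD
  refine ⟨fun v => hN.integrable_one _, PorousMedia.condK hT hN,
    ⟨PorousMedia.lbarExt hN hN', PorousMedia.extendsLbar_lbarExt hN hN',
      fun Λ hΛ => hΛ.eq hN1 (PorousMedia.extendsLbar_lbarExt hN hN')⟩, fun Λ hΛ => ?_⟩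
  -- By uniqueness an arbitrary extension is the explicit pairing, to which the bounds above apply.
  obtain rfl : Λ = PorousMedia.lbarExt hN hN' :=
    hΛ.eq hN1 (PorousMedia.extendsLbar_lbarExt hN hN')
  obtain ⟨A, hA⟩ := hD.exists_isDrift hN (PorousMedia.lbarExt hN hN' :
    _ →L[ℝ] StrongDual ℝ (PorousMedia.VSpace N S J))
  obtain ⟨cB, hcB⟩ := hBLip
  have hLip : ∀ t ∈ Icc (0 : ℝ) T, ∀ (ω : Ω) (u v : PorousMedia.VSpace N S J),
      ‖B t u ω - B t v ω‖ ^ 2 ≤ cB * ‖PorousMedia.VSpace.toH (u - v)‖ ^ 2 := fun t ht ω u v => by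
    simpa using hcB t ht ω u v
  refine ⟨A, hA, hD.condH1 hA, ⟨2 * C + cB, fun t ht ω u v => ?_⟩, ?_, ?_⟩
  · have h1 := hD.monotone hA ht ω u v
    have h2 := hLip t ht ω u v
    linarith
  · have hε : 0 < 1 - ε₀ := sub_pos.2 hD.lt_one
    -- `R` contains `‖v‖_H²`, so `-c₂ R` subtracts `2 * (1 - ε₀)` times this square; the same amount
    -- in `c₁` compensates for it. The term `2 * |cB|` and the summand `2‖B(t,0)‖²` of the new `f`
    -- come from `(a + b)² ≤ 2a² + 2b²`.
    refine ⟨2 * |C| + 2 * |cB| + 2 * (1 - ε₀), 2 * (1 - ε₀), _, by positivity, by positivity,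
      (hD.f_adapted.const_mul (2 * (PorousMedia.finInd m * m.real univ))).add
        ((PorousMedia.adaptedL1_norm_sq hB 0 hB0).const_mul 2), fun t ht ω v => ?_⟩
    have h1 := hD.coercive hA ht ω v
    have h2 := hLip t ht ω v 0
    rw [sub_zero] at h2
    have h3 : ‖B t v ω‖ ≤ ‖B t v ω - B t 0 ω‖ + ‖B t 0 ω‖ := by
      simpa using norm_add_le (B t v ω - B t 0 ω) (B t 0 ω)
    have h4 : ‖B t v ω‖ ^ 2 ≤ 2 * ‖B t v ω - B t 0 ω‖ ^ 2 + 2 * ‖B t 0 ω‖ ^ 2 := by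
      nlinarith [norm_nonneg (B t v ω), sq_nonneg (‖B t v ω - B t 0 ω‖ - ‖B t 0 ω‖)]
    have hv := sq_nonneg ‖PorousMedia.VSpace.toH v‖
    have h5 := mul_le_mul_of_nonneg_right (le_abs_self C) hv
    have h6 := mul_le_mul_of_nonneg_right (le_abs_self cB) hv
    rw [PorousMedia.RFun_eq]
    linarith
  · refine ⟨|c| + |C| + 1, _, by positivity,
      hD.f_adapted.const_mul (c * PorousMedia.finInd m * m.real univ), fun t ht ω u v => ?_⟩
    exact hD.growth hA ht ω u v
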